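/- Let $G^\sigma$ be a finite oriented graph, that is, a finite simple graph $G$ together with a choice of a direction for each of its edges. Let $A(G)$ be the adjacency matrix of $G$ and $r(G)$ its rank. Let $S(G^\sigma)=(s_{uv})$ be the skew-adjacency matrix, where $s_{uv}=1$ if $(u,v)$ is an arc of $G^\sigma$, $s_{uv}=-1$ if $(v,u)$ is an arc, and $s_{uv}=0$ otherwise, and let $sr(G^\sigma)$ be its rank (both ranks are over $\mathbb{R}$). Let $d(G)=|E(G)|-|V(G)|+\theta(G)$, where $\theta(G)$ is the number of connected components of $G$. A cycle $v_1v_2\cdots v_qv_1$ of $G$ of even length $q$ is called evenly-oriented if $\prod_{i=1}^{q}s_{v_iv_{i+1}}>0$, where $v_{q+1}=v_1$. A $\delta$-transformation of a graph deletes a vertex of degree $1$ together with its unique neighbour (and all edges incident with these two vertices). Theorem. The equality $sr(G^\sigma)=r(G)-2d(G)$ holds if and only if the following three conditions all hold. (1) Any two distinct cycles of $G$ have no common vertex. (2) Every cycle of $G$ has length $q\equiv 2\pmod 4$ and is evenly-oriented in $G^\sigma$. (3) Some finite (possibly empty) sequence of $\delta$-transformations, each applied to the graph produced by the previous one, turns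 $G$ into an induced subgraph $G_0$ that is the disjoint union of $d(G)$ cycles together with some (possibly no) isolated vertices; here $G_0$ may have no vertices at all. -/

import Mathlib

/-- An oriented graph on the vertex set `V`: a digraph without loops in which two vertices are
joined by at most one arc. -/
structure OrientedGraph (V : Type*) extends Digraph V where
  asymm : ∀ u v : V, Adj u v → ¬ Adj v u

namespace OrientedGraph

variable {V : Type*}

/-- The underlying simple graph `G` of an oriented graph `G^σ`. -/
def underlying (G : OrientedGraph V) : SimpleGraph V where
  Adj u v := G.Adj u v ∨ G.Adj v u
  symm := ⟨fun _ _ h => h.symm⟩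
  loopless := ⟨fun v h => h.elim (fun h => G.asymm v v h h) (fun h => G.asymm v v h h)⟩

open Classical in
/-- The skew-adjacency matrix: the entry at `(u, v)` is `1` if `(u, v)` is an arc, `-1` if
`(v, u)` is an arc, and `0` otherwise. -/
noncomputable def skewMatrix (G : OrientedGraph V) : Matrix V V ℝ :=
  Matrix.of fun u v => if G.Adj u v then 1 else if G.Adj v u then -1 else 0

/-- The skew-rank `sr(G^σ)`. -/
noncomputable def skewRank [Fintype V] (G : OrientedGraph V) : ℕ :=
  G.skewMatrix.rank

/-- A cycle `v₁ v₂ ⋯ vₙ v₁` of even length is evenly-oriented if the product of the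
skew-adjacency entries `s(vᵢ, vᵢ₊₁)` along it is positive. -/
def EvenlyOriented (G : OrientedGraph V) {v : V} (c : G.underlying.Walk v v) : Prop :=
  Even c.length ∧ 0 < (c.darts.map fun d => G.skewMatrix d.fst d.snd).prod

end OrientedGraph

namespace SimpleGraph

variable {V : Type*}

open Classical in
/-- The rank `r(G)` of the adjacency matrix of `G`. -/
noncomputable def adjRank [Fintype V] (G : SimpleGraph V) : ℕ :=
  (G.adjMatrix ℝ).rank

/-- The dimension of the cycle space, `d(G) = |E(G)| - |V(G)| + θ(G)`, where `θ(G)` is the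
number of connected components. -/
noncomputable def cycleDim (G : SimpleGraph V) : ℤ :=
  (Nat.card G.edgeSet : ℤ) - (Nat.card V : ℤ) + (Nat.card G.ConnectedComponent : ℤ)

/-- A cycle of `G` as a subgraph, that is, without a choice of base point and direction. -/
def IsCycleSubgraph (G : SimpleGraph V) (C : G.Subgraph) : Prop :=
  ∃ (v : V) (c : G.Walk v v), c.IsCycle ∧ c.toSubgraph = C

/-- Distinct cycles of `G` have no common vertex. -/
def CyclesPairwiseDisjoint (G : SimpleGraph V) : Prop :=
  ∀ C D : G.Subgraph, G.IsCycleSubgraph C → G.IsCycleSubgraph D → C ≠ D →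
    Disjoint C.verts D.verts

/-- A pendant vertex: a vertex of degree one. -/
def IsPendant (G : SimpleGraph V) (v : V) : Prop :=
  (G.neighborSet v).ncard = 1

/-- One `δ`-transformation among the induced subgraphs of `G`: the subgraph induced by `W'` arises
from the one induced by `W` by deleting a pendant vertex `y` of the latter and its neighbour `x`. -/
def DeltaStep (G : SimpleGraph V) (W W' : Set V) : Prop :=
  ∃ y x : W, (G.induce W).IsPendant y ∧ (G.induce W).Adj y x ∧
    W' = W \ {(y : V), (x : V)}

/-- `G` is the disjoint union of `k` cycles together with some (possibly no) isolated vertices: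
there are `k` pairwise vertex-disjoint cycles that contain all the edges of `G`. -/
def IsDisjointCyclesWithIsolated (G : SimpleGraph V) (k : ℕ) : Prop :=
  ∃ C : Fin k → G.Subgraph, (∀ i, G.IsCycleSubgraph (C i)) ∧
    (∀ i j, i ≠ j → Disjoint (C i).verts (C j).verts) ∧
    ∀ u v, G.Adj u v → ∃ i, (C i).Adj u v

/-- Finitely many (possibly no) `δ`-transformations reduce `G` to an induced subgraph that is the
disjoint union of `d(G)` cycles together with some isolated vertices. -/
def ReducesToDisjointCycles (G : SimpleGraph V) : Prop :=
  ∃ (W : Set V) (k : ℕ), Relation.ReflTransGen G.DeltaStep Set.univ W ∧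
    (k : ℤ) = G.cycleDim ∧ (G.induce W).IsDisjointCyclesWithIsolated k

end SimpleGraph

/-- `G^σ` is lower-optimal if `sr(G^σ) = r(G) - 2 d(G)`. -/
def OrientedGraph.LowerOptimal {V : Type*} [Fintype V] (G : OrientedGraph V) : Prop :=
  (G.skewRank : ℤ) = (G.underlying.adjRank : ℤ) - 2 * G.underlying.cycleDim

/-! For a vertex set `W` let n_A(W) and n_S(W) be the kernel dimensions of the principal submatrices
of the adjacency and skew-adjacency matrices, and d(W) the dimension of the space of flows
(antisymmetric, divergence-free edge functions) inside `W`. Since d(V) is the cycle dimension, the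
equality to be characterised is n_S(V) = n_A(V) + 2d(V).

The inequality n_S ≤ n_A + 2d always holds (`nullity_skewMatrix_le`). Deleting a vertex that carries
a flow lowers d by at least one and moves each nullity by at most one; in a forest, removing a
pendant vertex with its neighbour changes neither nullity.

Necessity is the equality case. Every estimate is then tight: deleting a vertex on a cycle lowers d
and n_S by exactly one and raises n_A by one, and pendant deletions lose no flow. A drop of d by
only one makes all flows proportional at that vertex, so cycles that meet coincide. The hard point
is `pendantFreeEdgesCarryFlow`: once no pendant vertex is left, no edge is a bridge. A bridge
leaving a cycle vertex would, through a kernel vector of the skew matrix, yield a pendant vertex on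
its far side. The cycles are therefore whole components, and following a kernel vector around one
gives its length mod 4 and its orientation.

Sufficiency: pendant deletions preserve both nullities, and in the reduced graph each good cycle
contributes at least two to n_S and nothing to n_A. Hence n_S ≥ n_A + 2d, and the general inequality
gives equality. -/

open Module

namespace OrientedGraph

/-! ### Nullities of principal submatrices. -/

section NullSpaces

variable {V : Type*} [Fintype V]

/-- The vectors supported on `W` that are annihilated by the rows of `M` indexed by `W`; this is
the kernel of the principal submatrix of `M` on `W`. -/
def nullOn (M : Matrix V V ℝ) (W : Set V) : Submodule ℝ (V → ℝ) where
  carrier := {z | (∀ u ∉ W, z u = 0) ∧ ∀ u ∈ W, M.mulVec z u = 0}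
  add_mem' := by
    rintro z z' ⟨h1, h2⟩ ⟨h3, h4⟩
    refine ⟨fun u hu => by simp [h1 u hu, h3 u hu], fun u hu => ?_⟩
    simp [Matrix.mulVec_add, h2 u hu, h4 u hu]
  zero_mem' := by simp
  smul_mem' := by
    rintro c z ⟨h1, h2⟩
    refine ⟨fun u hu => by simp [h1 u hu], fun u hu => ?_⟩
    simp [Matrix.mulVec_smul, h2 u hu]

theorem mem_nullOn {M : Matrix V V ℝ} {W : Set V} {z : V → ℝ} :
    z ∈ nullOn M W ↔ (∀ u ∉ W, z u = 0) ∧ ∀ u ∈ W, M.mulVec z u = 0 := Iff.rfl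

/-- The dimension of the kernel of the principal submatrix of `M` on `W`. -/
noncomputable def nullity (M : Matrix V V ℝ) (W : Set V) : ℕ := finrank ℝ (nullOn M W)

theorem rank_add_nullity_univ (M : Matrix V V ℝ) :
    M.rank + nullity M Set.univ = Fintype.card V := by
  have h : nullOn M Set.univ = LinearMap.ker M.mulVecLin := by
    ext z
    simp [mem_nullOn, funext_iff]
  rw [nullity, h, Matrix.rank, LinearMap.finrank_range_add_finrank_ker, finrank_fintype_fun_eq_card]

/-- Rank-nullity for `φ` on `P`: the range is at most a line and the kernel lies in `Q`. Vertex
deletions use it with a coordinate or a row as `φ`. -/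
theorem finrank_le_finrank_add_one {E : Type*} [AddCommGroup E] [Module ℝ E]
    [FiniteDimensional ℝ E] {P Q : Submodule ℝ E} (φ : E →ₗ[ℝ] ℝ)
    (h : ∀ z ∈ P, φ z = 0 → z ∈ Q) : finrank ℝ P ≤ finrank ℝ Q + 1 := by
  have h1 := LinearMap.finrank_range_add_finrank_ker (φ.comp P.subtype)
  have h2 : finrank ℝ (LinearMap.range (φ.comp P.subtype)) ≤ 1 := by
    simpa using Submodule.finrank_le (LinearMap.range (φ.comp P.subtype))
  have h3 : finrank ℝ (LinearMap.ker (φ.comp P.subtype)) ≤ finrank ℝ Q := by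
    let g : LinearMap.ker (φ.comp P.subtype) →ₗ[ℝ] Q :=
      LinearMap.codRestrict Q (P.subtype.comp (Submodule.subtype _))
        (fun z => h _ z.1.2 (LinearMap.mem_ker.1 z.2))
    refine LinearMap.finrank_le_finrank_of_injective (f := g) ?_
    intro x y hxy
    have := congrArg Subtype.val hxy
    exact Subtype.ext (Subtype.ext this)
  omega

variable {M : Matrix V V ℝ} {W : Set V}

theorem nullity_le_delete (M : Matrix V V ℝ) (W : Set V) (v : V) :
    nullity M W ≤ nullity M (W \ {v}) + 1 := by
  refine finrank_le_finrank_add_one (LinearMap.proj v) fun z hz h => ?_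
  refine ⟨fun u hu => ?_, fun u hu => hz.2 u hu.1⟩
  by_cases huv : u = v
  · subst huv; exact h
  · exact hz.1 u fun hW => hu ⟨hW, huv⟩

theorem nullity_delete_le (M : Matrix V V ℝ) (W : Set V) (v : V) :
    nullity M (W \ {v}) ≤ nullity M W + 1 := by
  refine finrank_le_finrank_add_one ((LinearMap.proj v).comp M.mulVecLin) fun z hz h => ?_
  refine ⟨fun u hu => hz.1 u fun h => hu h.1, fun u hu => ?_⟩
  by_cases huv : u = v
  · subst huv; exact h
  · exact hz.2 u ⟨hu, huv⟩

theorem exists_mem_nullOn_apply_ne_zero {v : V} (h : nullity M (W \ {v}) < nullity M W) :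
    ∃ z ∈ nullOn M W, z v ≠ 0 := by
  by_contra! hz
  refine absurd h (not_lt.2 (Submodule.finrank_mono fun z hzm => ?_))
  refine ⟨fun u hu => ?_, fun u hu => hzm.2 u hu.1⟩
  by_cases huv : u = v
  · subst huv; exact hz z hzm
  · exact hzm.1 u fun hW => hu ⟨hW, huv⟩

theorem exists_mem_nullOn_mulVec_ne_zero {v : V} (h : nullity M W < nullity M (W \ {v})) :
    ∃ z ∈ nullOn M (W \ {v}), M.mulVec z v ≠ 0 := by
  by_contra! hz
  refine absurd h (not_lt.2 (Submodule.finrank_mono fun z hzm => ?_))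
  refine ⟨fun u hu => hzm.1 u fun h => hu h.1, fun u hu => ?_⟩
  by_cases huv : u = v
  · subst huv; exact hz z hzm
  · exact hzm.2 u ⟨hu, huv⟩

theorem mulVec_apply_eq_of_forall {z z' : V → ℝ} {u : V} (h : ∀ v, M u v ≠ 0 → z v = z' v) :
    M.mulVec z u = M.mulVec z' u := by
  simp only [Matrix.mulVec, dotProduct]
  refine Finset.sum_congr rfl fun v _ => ?_
  by_cases hv : M u v = 0
  · simp [hv]
  · rw [h v hv]

open Classical in
theorem mulVec_update (M : Matrix V V ℝ) (z : V → ℝ) (y : V) (t : ℝ) (u : V) :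
    M.mulVec (Function.update z y t) u = M.mulVec z u + M u y * (t - z y) := by
  simp only [Matrix.mulVec, dotProduct]
  rw [← Finset.add_sum_erase _ _ (Finset.mem_univ y),
    ← Finset.add_sum_erase _ (fun v => M u v * z v) (Finset.mem_univ y)]
  rw [Finset.sum_congr rfl (g := fun v => M u v * z v)
    (fun v hv => by rw [Function.update_of_ne (Finset.ne_of_mem_erase hv)])]
  simp
  ring

open Classical in
/-- Deleting a pendant index together with its neighbour does not change the nullity. -/
theorem nullity_delete_pendant {x y : V} (hx : x ∈ W) (hy : y ∈ W) (hxy : x ≠ y)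
    (hM : ∀ u v, M u v = 0 ↔ M v u = 0) (h1 : M y x ≠ 0)
    (h2 : ∀ u ∈ W, M y u ≠ 0 → u = x) :
    nullity M (W \ {y, x}) = nullity M W := by
  have hyy : M y y = 0 := by
    by_contra h
    exact hxy (h2 y hy h).symm
  have h2' : ∀ u ∈ W, u ≠ x → M u y = 0 := fun u hu hux => by
    rw [hM]; by_contra h; exact hux (h2 u hu h)
  have hxy' : M x y ≠ 0 := fun h => h1 ((hM _ _).1 h)
  have row : ∀ z : V → ℝ, (∀ u ∉ W, z u = 0) → M.mulVec z y = M y x * z x := by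
    intro z hz
    simp only [Matrix.mulVec, dotProduct]
    refine Finset.sum_eq_single x (fun u _ hu => ?_) (by simp)
    by_cases huW : u ∈ W
    · have : M y u = 0 := by by_contra h; exact hu (h2 u huW h)
      simp [this]
    · simp [hz u huW]
  apply le_antisymm
  -- Inside `W` the column of `y` meets only row `x`, so one value at `y` repairs that row and
  -- disturbs no other.
  · let c : (V → ℝ) → ℝ := fun z => - (M.mulVec z x) / M x y
    let g : nullOn M (W \ {y, x}) →ₗ[ℝ] nullOn M W :=
      { toFun := fun z => ⟨z.1 + c z.1 • Pi.single y 1, by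
          obtain ⟨z, hz⟩ := z
          have key : ∀ u, M.mulVec (z + c z • Pi.single y 1) u = M.mulVec z u + c z * M u y := by
            intro u
            rw [Matrix.mulVec_add, Matrix.mulVec_smul]
            simp
          refine ⟨fun u hu => ?_, fun u hu => ?_⟩
          · have : u ≠ y := fun h => hu (h ▸ hy)
            simp [hz.1 u fun h => hu h.1, this]
          · rw [key]
            by_cases hux : u = x
            · subst hux
              simp only [c]
              field_simp
              ring
            · by_cases huy : u = y
              · subst huy
                rw [row z (fun v hv => hz.1 v fun h => hv h.1), hyy, hz.1 x (by simp)]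
                simp
              · rw [hz.2 u ⟨hu, by simp [hux, huy]⟩, h2' u hu hux]
                simp⟩
        map_add' := fun z z' => by
          apply Subtype.ext
          simp only [c, Submodule.coe_add, Matrix.mulVec_add, Pi.add_apply]
          ext u
          simp
          ring
        map_smul' := fun r z => by
          apply Subtype.ext
          simp only [c, Submodule.coe_smul, Matrix.mulVec_smul, Pi.smul_apply]
          ext u
          simp
          ring }
    refine LinearMap.finrank_le_finrank_of_injective (f := g) ?_
    rw [injective_iff_map_eq_zero]
    intro z hz
    apply Subtype.ext
    ext u
    by_cases huy : u = y
    · subst huy; exact z.2.1 u (by simp)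
    · have := congrFun (congrArg Subtype.val hz) u
      simpa [g, huy] using this
  -- Conversely, row `y` forces `z x = 0`. The value at `y` can then be erased, and row `x` shows
  -- that nothing is lost.
  · have zx : ∀ z ∈ nullOn M W, z x = 0 := fun z hz => by
      have := hz.2 y hy
      rw [row z hz.1] at this
      simpa [h1] using this
    let g : nullOn M W →ₗ[ℝ] nullOn M (W \ {y, x}) :=
      { toFun := fun z => ⟨Function.update z.1 y 0, by
          obtain ⟨z, hz⟩ := z
          refine ⟨fun u hu => ?_, fun u hu => ?_⟩
          · by_cases huy : u = y
            · simp [huy]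
            · rw [Function.update_of_ne huy]
              by_cases hux : u = x
              · rw [hux]; exact zx z hz
              · exact hz.1 u fun h => hu ⟨h, by simp [hux, huy]⟩
          · rw [mulVec_update, hz.2 u hu.1, h2' u hu.1 (fun h => hu.2 (by simp [h]))]
            simp⟩
        map_add' := fun z z' => by
          apply Subtype.ext
          ext u
          by_cases huy : u = y
          · simp [huy]
          · simp [huy]
        map_smul' := fun r z => by
          apply Subtype.ext
          ext u
          by_cases huy : u = y
          · simp [huy]
          · simp [huy] }
    refine LinearMap.finrank_le_finrank_of_injective (f := g) ?_
    rw [injective_iff_map_eq_zero]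
    intro z hz
    have hz' : ∀ u, u ≠ y → z.1 u = 0 := fun u hu => by
      have := congrFun (congrArg Subtype.val hz) u
      simpa [g, hu] using this
    apply Subtype.ext
    ext u
    by_cases huy : u = y
    · subst huy
      have hr := z.2.2 x hx
      have : M.mulVec z.1 x = M x u * z.1 u := by
        simp only [Matrix.mulVec, dotProduct]
        refine Finset.sum_eq_single u (fun v _ hv => by simp [hz' v hv]) (by simp)
      rw [this] at hr
      simpa [hxy'] using hr
    · exact hz' u huy

/-- The nullity is additive over parts that are not joined by an edge. -/
theorem nullity_disjoint_union {P Q : Set V} (hd : Disjoint P Q)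
    (h : ∀ u ∈ P, ∀ v ∈ Q, M u v = 0 ∧ M v u = 0) :
    nullity M (P ∪ Q) = nullity M P + nullity M Q := by
  have hP : nullOn M P ≤ nullOn M (P ∪ Q) := by
    intro z hz
    refine ⟨fun u hu => hz.1 u fun h => hu (Or.inl h), fun u hu => ?_⟩
    rcases hu with hu | hu
    · exact hz.2 u hu
    · rw [mulVec_apply_eq_of_forall (z' := 0)]
      · simp
      · intro v hv
        exact hz.1 v fun hvP => hv (h v hvP u hu).2
  have hQ : nullOn M Q ≤ nullOn M (P ∪ Q) := by
    intro z hz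
    refine ⟨fun u hu => hz.1 u fun h => hu (Or.inr h), fun u hu => ?_⟩
    rcases hu with hu | hu
    · rw [mulVec_apply_eq_of_forall (z' := 0)]
      · simp
      · intro v hv
        exact hz.1 v fun hvP => hv (h u hu v hvP).1
    · exact hz.2 u hu
  have hinf : nullOn M P ⊓ nullOn M Q = ⊥ := by
    rw [eq_bot_iff]
    rintro z ⟨hz1, hz2⟩
    rw [Submodule.mem_bot]
    ext u
    by_cases hu : u ∈ P
    · exact hz2.1 u (Set.disjoint_left.1 hd hu)
    · exact hz1.1 u hu
  have hsup : nullOn M P ⊔ nullOn M Q = nullOn M (P ∪ Q) := by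
    refine le_antisymm (sup_le hP hQ) fun z hz => ?_
    classical
    have hsplit : z = P.indicator z + Q.indicator z := by
      ext u
      by_cases h1 : u ∈ P
      · simp [h1, Set.disjoint_left.1 hd h1]
      · by_cases h2 : u ∈ Q
        · simp [h1, h2]
        · simp [h1, h2, hz.1 u (by simp [h1, h2])]
    rw [hsplit]
    refine Submodule.add_mem_sup ⟨fun u hu => by simp [hu], fun u hu => ?_⟩
      ⟨fun u hu => by simp [hu], fun u hu => ?_⟩
    · rw [← hz.2 u (Or.inl hu)]
      refine mulVec_apply_eq_of_forall fun v hv => ?_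
      by_cases h1 : v ∈ P
      · simp [h1]
      · have h2 : v ∉ Q := fun h2 => hv (h u hu v h2).1
        simp [h1, hz.1 v (by simp [h1, h2])]
    · rw [← hz.2 u (Or.inr hu)]
      refine mulVec_apply_eq_of_forall fun v hv => ?_
      by_cases h1 : v ∈ Q
      · simp [h1]
      · have h2 : v ∉ P := fun h2 => hv (h v h2 u hu).2
        simp [h1, hz.1 v (by simp [h1, h2])]
  have := Submodule.finrank_sup_add_finrank_inf_eq (nullOn M P) (nullOn M Q)
  rw [hsup, hinf] at this
  simpa [nullity] using this

/-- If `e_b` lies in the column space of a skew-symmetric principal submatrix, deleting `b`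
increases the nullity. -/
theorem nullity_lt_delete_of_mulVec_eq {b : V} (hM : ∀ u v, M v u = - M u v) (hb : b ∈ W)
    {x : V → ℝ} (hx : ∀ u ∉ W, x u = 0) (hxb : M.mulVec x b ≠ 0)
    (hxu : ∀ u ∈ W, u ≠ b → M.mulVec x u = 0) :
    nullity M W < nullity M (W \ {b}) := by
  have skew : ∀ z w : V → ℝ, z ⬝ᵥ M.mulVec w = - (w ⬝ᵥ M.mulVec z) := by
    intro z w
    have hMt : M.transpose = -M := by ext u v; simp [hM u v]
    rw [Matrix.dotProduct_mulVec, ← Matrix.mulVec_transpose, hMt, dotProduct_comm,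
      Matrix.neg_mulVec, dotProduct_neg]
  have pair : ∀ z : V → ℝ, (∀ u ∉ W, z u = 0) → z ⬝ᵥ M.mulVec x = z b * M.mulVec x b := by
    intro z hz
    refine Finset.sum_eq_single b (fun u _ hu => ?_) (by simp)
    by_cases huW : u ∈ W
    · rw [hxu u huW hu, mul_zero]
    · rw [hz u huW, zero_mul]
  -- Pair `z` with `M x`: the result is `z b` times a nonzero number, and by skewness also minus the
  -- pairing of `x` with `M z`, which is zero.
  have hz0 : ∀ z ∈ nullOn M W, z b = 0 := by
    intro z hz
    have h1 := pair z hz.1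
    rw [skew, show x ⬝ᵥ M.mulVec z = 0 from Finset.sum_eq_zero fun u _ => by
      by_cases huW : u ∈ W
      · rw [hz.2 u huW, mul_zero]
      · rw [hx u huW, zero_mul]] at h1
    simpa [hxb] using h1.symm
  -- A skew form vanishes on the diagonal. So `x` itself lies in the kernel after deleting `b`, but
  -- not before.
  have hxb0 : x b = 0 := by
    have h1 := pair x hx
    have h2 := skew x x
    have : x b * M.mulVec x b = 0 := by linarith
    simpa [hxb] using this
  refine Submodule.finrank_lt_finrank_of_lt (lt_of_le_of_ne ?_ ?_)
  · intro z hz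
    refine ⟨fun u hu => ?_, fun u hu => hz.2 u hu.1⟩
    by_cases hub : u = b
    · subst hub; exact hz0 z hz
    · exact hz.1 u fun h => hu ⟨h, hub⟩
  · intro heq
    have : x ∈ nullOn M W := by
      rw [heq]
      refine ⟨fun u hu => ?_, fun u hu => hxu u hu.1 hu.2⟩
      by_cases hub : u = b
      · subst hub; exact hxb0
      · exact hx u fun h => hu ⟨h, hub⟩
    exact hxb (this.2 b hb)

end NullSpaces

end OrientedGraph

namespace SimpleGraph

/-! ### Unit flows along walks. -/

section WalkFlows

variable {V : Type*}

open Classical in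
/-- The unit flow along a walk. -/
noncomputable def walkFlow {H : SimpleGraph V} {a b : V} (p : H.Walk a b) : V → V → ℝ :=
  fun x y => ((p.darts.map Dart.toProd).count (x, y) : ℝ) -
    ((p.darts.map Dart.toProd).count (y, x) : ℝ)

theorem walkFlow_antisymm {H : SimpleGraph V} {a b : V} (p : H.Walk a b) (x y : V) :
    walkFlow p x y = - walkFlow p y x := by
  simp [walkFlow]

theorem mem_edges_of_walkFlow_ne_zero {H : SimpleGraph V} {a b : V} {p : H.Walk a b} {x y : V}
    (h : walkFlow p x y ≠ 0) : s(x, y) ∈ p.edges := by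
  classical
  have h' : (x, y) ∈ p.darts.map Dart.toProd ∨ (y, x) ∈ p.darts.map Dart.toProd := by
    by_contra! hc
    apply h
    rw [walkFlow, List.count_eq_zero_of_not_mem hc.1, List.count_eq_zero_of_not_mem hc.2, sub_self]
  rw [Walk.edges, List.mem_map]
  rcases h' with h' | h' <;> obtain ⟨d, hd, hdx⟩ := List.mem_map.1 h'
  · exact ⟨d, hd, by rw [Dart.edge, hdx]⟩
  · exact ⟨d, hd, by rw [Dart.edge, hdx, Sym2.eq_swap]⟩

/-- A trail uses each edge once, so opposite traversals cannot cancel. -/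
theorem Walk.IsTrail.walkFlow_ne_zero {H : SimpleGraph V} {a b : V} {p : H.Walk a b}
    (hp : p.IsTrail) {x y : V} (h : s(x, y) ∈ p.edges) : walkFlow p x y ≠ 0 := by
  classical
  have key : ∀ x y : V, (x, y) ∈ p.darts.map Dart.toProd → walkFlow p x y ≠ 0 := by
    intro x y hxy
    have hnd : (p.darts.map Dart.edge).Nodup := hp.edges_nodup
    have h1 : (y, x) ∉ p.darts.map Dart.toProd := by
      intro hyx
      obtain ⟨d, hd, hdx⟩ := List.mem_map.1 hxy
      obtain ⟨d', hd', hdx'⟩ := List.mem_map.1 hyx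
      have hedge : d.edge = d'.edge := by rw [Dart.edge, Dart.edge, hdx, hdx', Sym2.eq_swap]
      have := List.inj_on_of_nodup_map hnd hd hd' hedge
      subst this
      rw [hdx, Prod.mk.injEq] at hdx'
      have hadj := d.adj
      rw [hdx] at hadj
      exact hadj.ne hdx'.1
    have h2 : 0 < (p.darts.map Dart.toProd).count (x, y) := List.count_pos_iff.2 hxy
    rw [walkFlow, List.count_eq_zero_of_not_mem h1]
    have : (0 : ℝ) < ((p.darts.map Dart.toProd).count (x, y) : ℝ) := by exact_mod_cast h2
    simp only [Nat.cast_zero, sub_zero]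
    exact this.ne'
  rw [Walk.edges, List.mem_map] at h
  obtain ⟨d, hd, hde⟩ := h
  rcases dart_edge_eq_mk'_iff.1 hde with h | h
  · exact key x y (List.mem_map.2 ⟨d, hd, h⟩)
  · rw [walkFlow_antisymm, neg_ne_zero]
    exact key y x (List.mem_map.2 ⟨d, hd, h⟩)

variable {G : SimpleGraph V} {W : Set V}

/-- The spanning subgraph of `G` formed by the edges inside `W`. -/
def inside (G : SimpleGraph V) (W : Set V) : SimpleGraph V where
  Adj u v := G.Adj u v ∧ u ∈ W ∧ v ∈ W
  symm := ⟨fun _ _ h => ⟨h.1.symm, h.2.2, h.2.1⟩⟩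
  loopless := ⟨fun _ h => h.1.ne rfl⟩

theorem inside_le : G.inside W ≤ G := fun _ _ h => h.1

theorem support_subset_of_inside {a b : V} (p : (G.inside W).Walk a b) (ha : a ∈ W) :
    ∀ u ∈ p.support, u ∈ W := by
  induction p with
  | nil => intro u hu; simp at hu; exact hu ▸ ha
  | cons h p ih =>
    intro u hu
    rw [Walk.support_cons, List.mem_cons] at hu
    rcases hu with rfl | hu
    · exact ha
    · exact ih h.2.2 u hu

/-- `y` has `x` as its only neighbour inside `W`. -/
structure PendantIn (G : SimpleGraph V) (W : Set V) (y x : V) : Prop where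
  left_mem : y ∈ W
  right_mem : x ∈ W
  adj : G.Adj y x
  eq_of_adj : ∀ u ∈ W, G.Adj y u → u = x

end WalkFlows

/-! ### Flows as the cycle space of an induced subgraph. -/

section Flows

variable {V : Type*} [Fintype V]

/-- The flows (elements of the cycle space) carried by the edges of `G` inside `W`, as
antisymmetric functions of zero divergence. -/
def flowOn (G : SimpleGraph V) (W : Set V) : Submodule ℝ (V → V → ℝ) where
  carrier := {f | (∀ u v, f u v = - f v u) ∧ (∀ u v, f u v ≠ 0 → G.Adj u v ∧ u ∈ W ∧ v ∈ W) ∧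
    ∀ u, ∑ v, f u v = 0}
  add_mem' := by
    rintro f g ⟨h1, h2, h3⟩ ⟨h4, h5, h6⟩
    refine ⟨fun u v => ?_, fun u v h => ?_, fun u => ?_⟩
    · simp only [Pi.add_apply, h1 u v, h4 u v]; ring
    · by_cases hf : f u v = 0
      · by_cases hg : g u v = 0
        · simp [hf, hg] at h
        · exact h5 u v hg
      · exact h2 u v hf
    · simp [Finset.sum_add_distrib, h3, h6]
  zero_mem' := by simp
  smul_mem' := by
    rintro c f ⟨h1, h2, h3⟩
    refine ⟨fun u v => ?_, fun u v h => h2 u v fun h' => h (by simp [h']), fun u => ?_⟩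
    · simp only [Pi.smul_apply, smul_eq_mul, h1 u v]; ring
    · simp [← Finset.mul_sum, h3]

/-- The dimension of the cycle space of the subgraph of `G` induced by `W`. -/
noncomputable def flowDim (G : SimpleGraph V) (W : Set V) : ℕ := finrank ℝ (G.flowOn W)

/-- The vertices at which some flow inside `W` does not vanish. -/
def flowVerts (G : SimpleGraph V) (W : Set V) : Set V :=
  {v | ∃ f ∈ G.flowOn W, ∃ u, f v u ≠ 0}

variable {G : SimpleGraph V} {W W' : Set V}

theorem flowOn_mono (h : W' ⊆ W) : G.flowOn W' ≤ G.flowOn W :=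
  fun _ hf => ⟨hf.1, fun u v huv => ⟨(hf.2.1 u v huv).1, h (hf.2.1 u v huv).2.1,
    h (hf.2.1 u v huv).2.2⟩, hf.2.2⟩

theorem flowDim_mono (h : W' ⊆ W) : G.flowDim W' ≤ G.flowDim W :=
  Submodule.finrank_mono (flowOn_mono h)

theorem flowVerts_mono (h : W' ⊆ W) : G.flowVerts W' ⊆ G.flowVerts W :=
  fun _ ⟨f, hf, hv⟩ => ⟨f, flowOn_mono h hf, hv⟩

theorem flowVerts_subset : G.flowVerts W ⊆ W := fun _ ⟨_, hf, u, hu⟩ => (hf.2.1 _ u hu).2.1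

theorem mem_flowVerts_right {f : V → V → ℝ} (hf : f ∈ G.flowOn W) {u v : V} (h : f u v ≠ 0) :
    v ∈ G.flowVerts W :=
  ⟨f, hf, u, fun h' => h (by rw [hf.1, h', neg_zero])⟩

theorem mem_flowOn_delete {f : V → V → ℝ} (hf : f ∈ G.flowOn W) {v : V} (h : ∀ u, f v u = 0) :
    f ∈ G.flowOn (W \ {v}) := by
  refine ⟨hf.1, fun x y hxy => ⟨(hf.2.1 x y hxy).1, ⟨(hf.2.1 x y hxy).2.1, ?_⟩,
    ⟨(hf.2.1 x y hxy).2.2, ?_⟩⟩, hf.2.2⟩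
  · rintro rfl; exact hxy (h y)
  · rintro rfl; exact hxy (by rw [hf.1, h, neg_zero])

theorem apply_eq_zero_of_mem_flowOn_delete {f : V → V → ℝ} {v : V}
    (hf : f ∈ G.flowOn (W \ {v})) (u : V) : f v u = 0 := by
  by_contra h
  exact (hf.2.1 v u h).2.1.2 rfl

theorem flowOn_delete_of_notMem {v : V} (h : v ∉ G.flowVerts W) :
    G.flowOn (W \ {v}) = G.flowOn W := by
  refine le_antisymm (flowOn_mono Set.sdiff_subset) fun f hf => mem_flowOn_delete hf fun u => ?_
  by_contra hu
  exact h ⟨f, hf, u, hu⟩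

theorem flowDim_delete_lt {v : V} (h : v ∈ G.flowVerts W) :
    G.flowDim (W \ {v}) < G.flowDim W := by
  refine Submodule.finrank_lt_finrank_of_lt (lt_of_le_of_ne (flowOn_mono Set.sdiff_subset) ?_)
  obtain ⟨f, hf, u, hu⟩ := h
  intro heq
  rw [← heq] at hf
  exact hu (apply_eq_zero_of_mem_flowOn_delete hf u)

/-- If deleting `v` lowers the dimension of the cycle space by only one, then all flows are
proportional at `v`. -/
theorem exists_sub_smul_mem_flowOn_delete {v : V} (h : G.flowDim W ≤ G.flowDim (W \ {v}) + 1)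
    {g f : V → V → ℝ} (hg : g ∈ G.flowOn W) {u : V} (hgu : g v u ≠ 0) (hf : f ∈ G.flowOn W) :
    ∃ c : ℝ, f - c • g ∈ G.flowOn (W \ {v}) := by
  refine ⟨f v u / g v u, ?_⟩
  set k := f - (f v u / g v u) • g with hk
  have hkW : k ∈ G.flowOn W := Submodule.sub_mem _ hf (Submodule.smul_mem _ _ hg)
  have hkv : k v u = 0 := by simp [hk, hgu]
  by_contra hkn
  -- Otherwise the flows vanishing on the pair `v`, `u` lie strictly between the two flow spaces,
  -- and the dimension drops by at least two.
  let P : Submodule ℝ (V → V → ℝ) := G.flowOn W ⊓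
    LinearMap.ker ((LinearMap.proj (R := ℝ) (φ := fun _ : V => ℝ) u).comp
      (LinearMap.proj (R := ℝ) (φ := fun _ : V => V → ℝ) v))
  have h1 : finrank ℝ (G.flowOn (W \ {v})) < finrank ℝ P := by
    refine Submodule.finrank_lt_finrank_of_lt (lt_of_le_of_ne ?_ ?_)
    · intro x hx
      exact ⟨flowOn_mono Set.sdiff_subset hx, by
        simpa using apply_eq_zero_of_mem_flowOn_delete hx u⟩
    · intro heq
      exact hkn (heq ▸ (⟨hkW, by simpa using hkv⟩ : k ∈ P))
  have h2 : finrank ℝ P < finrank ℝ (G.flowOn W) := by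
    refine Submodule.finrank_lt_finrank_of_lt (lt_of_le_of_ne inf_le_left ?_)
    intro heq
    rw [← heq] at hg
    exact hgu (by simpa using hg.2)
  unfold flowDim at h
  omega

theorem flowDim_disjoint_union {P Q : Set V} (hd : Disjoint P Q)
    (h : ∀ u ∈ P, ∀ v ∈ Q, ¬ G.Adj u v) :
    G.flowDim (P ∪ Q) = G.flowDim P + G.flowDim Q := by
  have hP : G.flowOn P ≤ G.flowOn (P ∪ Q) := flowOn_mono Set.subset_union_left
  have hQ : G.flowOn Q ≤ G.flowOn (P ∪ Q) := flowOn_mono Set.subset_union_right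
  have hinf : G.flowOn P ⊓ G.flowOn Q = ⊥ := by
    rw [eq_bot_iff]
    rintro f ⟨h1, h2⟩
    rw [Submodule.mem_bot]
    ext u v
    by_contra huv
    exact Set.disjoint_left.1 hd (h1.2.1 u v huv).2.1 (h2.2.1 u v huv).2.1
  have hsup : G.flowOn P ⊔ G.flowOn Q = G.flowOn (P ∪ Q) := by
    refine le_antisymm (sup_le hP hQ) fun f hf => ?_
    classical
    have hcross : ∀ u v, f u v ≠ 0 → (u ∈ P ∧ v ∈ P ∧ u ∉ Q ∧ v ∉ Q) ∨
        (u ∈ Q ∧ v ∈ Q ∧ u ∉ P ∧ v ∉ P) := by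
      intro u v huv
      obtain ⟨ha, hu, hv⟩ := hf.2.1 u v huv
      rcases hu with hu | hu <;> rcases hv with hv | hv
      · exact Or.inl ⟨hu, hv, Set.disjoint_left.1 hd hu, Set.disjoint_left.1 hd hv⟩
      · exact absurd ha (h u hu v hv)
      · exact absurd ha.symm (h v hv u hu)
      · exact Or.inr ⟨hu, hv, Set.disjoint_right.1 hd hu, Set.disjoint_right.1 hd hv⟩
    have hsplit : f = (fun u v => if u ∈ P then f u v else 0) +
        fun u v => if u ∈ Q then f u v else 0 := by
      ext u v
      by_cases huv : f u v = 0
      · simp [huv]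
      · rcases hcross u v huv with h' | h' <;> simp [h']
    rw [hsplit]
    refine Submodule.add_mem_sup ⟨fun u v => ?_, fun u v huv => ?_, fun u => ?_⟩
      ⟨fun u v => ?_, fun u v huv => ?_, fun u => ?_⟩
    · by_cases huv : f u v = 0
      · have := hf.1 v u
        simp [huv, this]
      · rcases hcross u v huv with h' | h' <;> simp [h', hf.1 u v]
    · have huv' : f u v ≠ 0 := fun h => huv (by simp [h])
      rcases hcross u v huv' with h' | h'
      · exact ⟨(hf.2.1 u v huv').1, h'.1, h'.2.1⟩
      · simp [h'] at huv
    · by_cases hu : u ∈ P <;> simp [hu, hf.2.2]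
    · by_cases huv : f u v = 0
      · have := hf.1 v u
        simp [huv, this]
      · rcases hcross u v huv with h' | h' <;> simp [h', hf.1 u v]
    · have huv' : f u v ≠ 0 := fun h => huv (by simp [h])
      rcases hcross u v huv' with h' | h'
      · simp [h'] at huv
      · exact ⟨(hf.2.1 u v huv').1, h'.1, h'.2.1⟩
    · by_cases hu : u ∈ Q <;> simp [hu, hf.2.2]
  have := Submodule.finrank_sup_add_finrank_inf_eq (G.flowOn P) (G.flowOn Q)
  rw [hsup, hinf] at this
  simpa [flowDim] using this

open Classical in
/-- The net flow out of a set of vertices vanishes. -/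
theorem sum_flow_cut {f : V → V → ℝ} (hf : f ∈ G.flowOn W) (B : Finset V) :
    ∑ u ∈ B, ∑ v ∈ Bᶜ, f u v = 0 := by
  have h1 : ∑ u ∈ B, ∑ v, f u v = 0 := Finset.sum_eq_zero fun u _ => hf.2.2 u
  have h2 : ∑ u ∈ B, ∑ v ∈ B, f u v = 0 := by
    have h3 : ∑ u ∈ B, ∑ v ∈ B, f u v = - ∑ u ∈ B, ∑ v ∈ B, f u v := by
      conv_lhs => rw [Finset.sum_comm]
      rw [← Finset.sum_neg_distrib]
      refine Finset.sum_congr rfl fun u _ => ?_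
      rw [← Finset.sum_neg_distrib]
      exact Finset.sum_congr rfl fun v _ => hf.1 v u
    linarith
  have h4 : ∑ u ∈ B, ∑ v, f u v = ∑ u ∈ B, ∑ v ∈ B, f u v + ∑ u ∈ B, ∑ v ∈ Bᶜ, f u v := by
    rw [← Finset.sum_add_distrib]
    exact Finset.sum_congr rfl fun u _ => (Finset.sum_add_sum_compl B _).symm
  linarith

open Classical in
theorem sum_walkFlow {H : SimpleGraph V} {a b : V} (p : H.Walk a b) (x : V) :
    ∑ y, walkFlow p x y = (if x = a then 1 else 0) - (if x = b then 1 else 0) := by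
  induction p with
  | nil => simp [walkFlow]
  | @cons u v w h p ih =>
    have hstep : ∀ y, walkFlow (Walk.cons h p) x y = walkFlow p x y +
        ((if x = u ∧ y = v then 1 else 0) - (if x = v ∧ y = u then 1 else 0)) := by
      intro y
      have e1 : ((u, v) = (x, y)) ↔ (x = u ∧ y = v) := by
        rw [Prod.mk.injEq]; exact ⟨fun h => ⟨h.1.symm, h.2.symm⟩, fun h => ⟨h.1.symm, h.2.symm⟩⟩
      have e2 : ((u, v) = (y, x)) ↔ (x = v ∧ y = u) := by
        rw [Prod.mk.injEq]; exact ⟨fun h => ⟨h.2.symm, h.1.symm⟩, fun h => ⟨h.2.symm, h.1.symm⟩⟩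
      simp only [walkFlow, Walk.darts_cons, List.map_cons, List.count_cons, beq_iff_eq, e1, e2]
      push_cast
      ring
    simp only [hstep, Finset.sum_add_distrib, ih, Finset.sum_sub_distrib]
    have s1 : ∑ y, (if x = u ∧ y = v then (1 : ℝ) else 0) = if x = u then 1 else 0 := by
      by_cases hx : x = u <;> simp [hx]
    have s2 : ∑ y, (if x = v ∧ y = u then (1 : ℝ) else 0) = if x = v then 1 else 0 := by
      by_cases hx : x = v <;> simp [hx]
    rw [s1, s2]
    ring

theorem walkFlow_mem_flowOn {v : V} (c : G.Walk v v) (hW : ∀ u ∈ c.support, u ∈ W) :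
    walkFlow c ∈ G.flowOn W := by
  refine ⟨walkFlow_antisymm c, fun x y h => ?_, fun x => by classical simp [sum_walkFlow]⟩
  have he := mem_edges_of_walkFlow_ne_zero h
  exact ⟨c.adj_of_mem_edges he, hW _ (c.fst_mem_support_of_mem_edges he),
    hW _ (c.snd_mem_support_of_mem_edges he)⟩

/-- An edge on which all flows vanish separates its ends. -/
theorem exists_side_of_flow_eq_zero {a b : V} (ha : a ∈ W) (hb : b ∈ W) (hab : G.Adj a b)
    (h0 : ∀ f ∈ G.flowOn W, f a b = 0) :
    ∃ B ⊆ W, b ∈ B ∧ a ∉ B ∧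
      ∀ u ∈ B, ∀ v ∈ W, G.Adj u v → v ∈ B ∨ (u = b ∧ v = a) := by
  classical
  set H := (G.inside W).deleteEdges {s(a, b)} with hH
  have hHW : H ≤ G.inside W := deleteEdges_le _
  refine ⟨{v | v ∈ W ∧ H.Reachable b v}, fun v hv => hv.1, ⟨hb, Reachable.refl _⟩, ?_, ?_⟩
  · rintro ⟨-, ⟨p⟩⟩
    have hnot : s(a, b) ∉ p.edges := by
      intro he
      have := p.adj_of_mem_edges he
      simp [hH, deleteEdges_adj] at this
    have hp0 : walkFlow p a b = 0 := by
      by_contra hne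
      exact hnot (mem_edges_of_walkFlow_ne_zero hne)
    -- A walk from `b` to `a` avoiding the edge closes up to a closed walk whose flow has value 1 on
    -- it.
    let c : G.Walk a a := Walk.cons hab (p.mapLe (hHW.trans inside_le))
    have hc : walkFlow c ∈ G.flowOn W := by
      refine walkFlow_mem_flowOn c fun u hu => ?_
      have hu' : u = a ∨ u ∈ (p.mapLe hHW).support := by simpa [c] using hu
      rcases hu' with rfl | hu'
      · exact ha
      · exact support_subset_of_inside _ hb u hu'
    have hnot' : s(a, b) ∉ (p.mapLe (hHW.trans inside_le)).edges := by
      rwa [Walk.edges_mapLe_eq_edges]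
    have hz : walkFlow (p.mapLe (hHW.trans inside_le)) a b = 0 := by
      by_contra hne
      exact hnot' (mem_edges_of_walkFlow_ne_zero hne)
    have hval : walkFlow c a b = walkFlow (p.mapLe (hHW.trans inside_le)) a b + 1 := by
      have e : ¬ ((a, b) = (b, a)) := fun h => hab.ne (Prod.mk.injEq _ _ _ _ ▸ h).1
      simp only [c, walkFlow, Walk.darts_cons, List.map_cons, List.count_cons, beq_iff_eq, e,
        if_true, if_false]
      push_cast
      ring
    rw [hz, h0 _ hc] at hval
    norm_num at hval
  · rintro u ⟨huW, hu⟩ v hv huv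
    by_cases he : s(u, v) = s(a, b)
    · rw [Sym2.eq_iff] at he
      rcases he with ⟨rfl, rfl⟩ | ⟨rfl, rfl⟩
      · exact Or.inl ⟨hv, Reachable.refl _⟩
      · exact Or.inr ⟨rfl, rfl⟩
    · refine Or.inl ⟨hv, hu.trans (Adj.reachable ?_)⟩
      rw [hH, deleteEdges_adj]
      exact ⟨⟨huv, huW, hv⟩, he⟩

/-- Every edge carrying a flow lies on a cycle. -/
theorem exists_isCycle_of_flow_ne_zero {f : V → V → ℝ} (hf : f ∈ G.flowOn W) {a b : V}
    (hab : f a b ≠ 0) :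
    ∃ (v : V) (c : G.Walk v v), c.IsCycle ∧ (∀ u ∈ c.support, u ∈ W) := by
  classical
  obtain ⟨hadj, ha, hb⟩ := hf.2.1 a b hab
  have hW : (G.inside W).Adj a b := ⟨hadj, ha, hb⟩
  -- If the edge were a bridge, it alone would cross the cut around the side of `a`, and the net
  -- flow `f a b` would be zero.
  have hreach : ((G.inside W).deleteEdges {s(a, b)}).Reachable a b := by
    by_contra hn
    let B : Finset V := Finset.univ.filter
      fun v => ((G.inside W).deleteEdges {s(a, b)}).Reachable a v
    have hB := sum_flow_cut hf B
    have haB : a ∈ B := by simp [B]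
    have hbB : b ∉ B := by simpa [B] using hn
    have hcross : ∀ u ∈ B, ∀ v ∈ Bᶜ, f u v ≠ 0 → u = a ∧ v = b := by
      intro u hu v hv huv
      by_contra hne
      have hadj' := hf.2.1 u v huv
      have hu' : ((G.inside W).deleteEdges {s(a, b)}).Reachable a u := by simpa [B] using hu
      have hv' : ¬ ((G.inside W).deleteEdges {s(a, b)}).Reachable a v := by simpa [B] using hv
      refine hv' (hu'.trans (Adj.reachable ?_))
      rw [deleteEdges_adj]
      refine ⟨hadj', fun he => ?_⟩
      rcases Sym2.eq_iff.1 he with h | ⟨rfl, rfl⟩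
      · exact hne h
      · exact hn hu'
    rw [Finset.sum_eq_single_of_mem a haB, Finset.sum_eq_single_of_mem b (by simpa using hbB)] at hB
    · exact hab hB
    · intro v hv hvb
      by_contra h
      exact hvb (hcross a haB v hv h).2
    · intro u hu hua
      refine Finset.sum_eq_zero fun v hv => ?_
      by_contra h
      exact hua (hcross u hu v hv h).1
  obtain ⟨u, p, hp, -⟩ := adj_and_reachable_delete_edges_iff_exists_cycle.1 ⟨hW, hreach⟩
  refine ⟨u, p.mapLe inside_le, hp.mapLe _, fun w hw => ?_⟩
  have hu : u ∈ W := by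
    have := p.adj_snd hp.not_nil
    exact this.2.1
  exact support_subset_of_inside p hu w (by simpa using hw)

theorem Walk.IsCycle.mem_flowVerts {v : V} {c : G.Walk v v} (hc : c.IsCycle)
    (hW : ∀ u ∈ c.support, u ∈ W) {u : V} (hu : u ∈ c.support) : u ∈ G.flowVerts W := by
  have hn : (c.toSubgraph.neighborSet u).ncard = 2 :=
    hc.ncard_neighborSet_toSubgraph_eq_two hu
  have hne : (c.toSubgraph.neighborSet u).Nonempty := by
    rw [← Set.ncard_pos]; omega
  obtain ⟨w, hw⟩ := hne
  exact ⟨walkFlow c, walkFlow_mem_flowOn c hW, w,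
    hc.isTrail.walkFlow_ne_zero (Walk.adj_toSubgraph_iff_mem_edges.1 hw)⟩

/-- A nonempty forest has a pendant vertex. -/
theorem exists_pendantIn_of_flowVerts_eq_empty (h : G.flowVerts W = ∅) {a b : V} (ha : a ∈ W)
    (hb : b ∈ W) (hab : G.Adj a b) : ∃ y x, G.PendantIn W y x := by
  classical
  have hac : (G.inside W).IsAcyclic := by
    intro v c hc
    have hv : v ∈ W := (c.adj_snd hc.not_nil).2.1
    have := (hc.mapLe inside_le).mem_flowVerts (W := W)
      (fun u hu => support_subset_of_inside c hv u (by simpa using hu)) (Walk.start_mem_support _)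
    rw [h] at this
    exact this
  let C := (G.inside W).connectedComponentMk a
  have hT := hac.isTree_connectedComponent C
  have hW : (G.inside W).Adj a b := ⟨hab, ha, hb⟩
  have haC : a ∈ C.supp := rfl
  have hbC : b ∈ C.supp := ConnectedComponent.sound hW.symm.reachable
  have : Nontrivial C.supp := ⟨⟨a, haC⟩, ⟨b, hbC⟩, fun h => hab.ne (congrArg Subtype.val h)⟩
  obtain ⟨y, hy⟩ := hT.exists_vert_degree_one_of_nontrivial
  rw [degree_eq_one_iff_existsUnique_adj] at hy
  obtain ⟨x, hx, hux⟩ := hy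
  have hx' : (G.inside W).Adj y x := hx
  refine ⟨y, x, hx'.2.1, hx'.2.2, hx'.1, fun u hu hyu => ?_⟩
  have hyu' : (G.inside W).Adj y u := ⟨hyu, hx'.2.1, hu⟩
  have huC : u ∈ C.supp := by
    have h1 : (G.inside W).connectedComponentMk u = (G.inside W).connectedComponentMk y :=
      ConnectedComponent.sound hyu'.symm.reachable
    have h2 : (G.inside W).connectedComponentMk (y : V) = C := y.2
    exact h1.trans h2
  exact congrArg Subtype.val (hux ⟨u, huC⟩ hyu')

end Flows

end SimpleGraph

namespace OrientedGraph

open SimpleGraph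

/-! ### The general inequality and its equality case. -/

section LowerBound

variable {V : Type*} (G : OrientedGraph V)

open Classical in
/-- The adjacency matrix of the underlying graph. -/
noncomputable def adjM : Matrix V V ℝ := G.underlying.adjMatrix ℝ

variable {G}

theorem adjM_apply_eq_one {u v : V} (h : G.underlying.Adj u v) : G.adjM u v = 1 := by
  classical simp [adjM, h]

theorem adjM_apply_ne_zero {u v : V} : G.adjM u v ≠ 0 ↔ G.underlying.Adj u v := by
  classical simp [adjM]

theorem adjM_eq_zero_comm (u v : V) : G.adjM u v = 0 ↔ G.adjM v u = 0 := by
  rw [← not_iff_not]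
  exact adjM_apply_ne_zero.trans ((G.underlying.adj_comm u v).trans adjM_apply_ne_zero.symm)

theorem skewMatrix_antisymm (u v : V) : G.skewMatrix v u = - G.skewMatrix u v := by
  have := G.asymm u v
  by_cases h1 : G.Adj u v
  · simp [skewMatrix, h1, this h1]
  · by_cases h2 : G.Adj v u <;> simp [skewMatrix, h1, h2]

theorem skewMatrix_apply_ne_zero {u v : V} : G.skewMatrix u v ≠ 0 ↔ G.underlying.Adj u v := by
  by_cases h1 : G.Adj u v
  · simp [skewMatrix, underlying, h1]
  · by_cases h2 : G.Adj v u <;> simp [skewMatrix, underlying, h1, h2]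

theorem skewMatrix_mul_self {u v : V} (h : G.underlying.Adj u v) :
    G.skewMatrix u v * G.skewMatrix u v = 1 := by
  by_cases h1 : G.Adj u v
  · simp [skewMatrix, h1]
  · have h2 : G.Adj v u := h.resolve_left h1
    simp [skewMatrix, h1, h2]

theorem skewMatrix_eq_zero_comm (u v : V) : G.skewMatrix u v = 0 ↔ G.skewMatrix v u = 0 := by
  rw [skewMatrix_antisymm u v, neg_eq_zero]

theorem exists_nbr_ne_of_not_pendantIn {W : Set V} {x w : V} (hx : x ∈ W) (hw : w ∈ W)
    (hxw : G.underlying.Adj x w) (hn : ¬ G.underlying.PendantIn W x w) :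
    ∃ u ∈ W, G.underlying.Adj x u ∧ u ≠ w := by
  by_contra! hc
  exact hn ⟨hx, hw, hxw, hc⟩

variable [Fintype V] {W : Set V}

theorem nullity_adjM_delete_pendant {y x : V} (h : G.underlying.PendantIn W y x) :
    nullity G.adjM (W \ {y, x}) = nullity G.adjM W :=
  nullity_delete_pendant h.right_mem h.left_mem h.adj.ne' adjM_eq_zero_comm
    (adjM_apply_ne_zero.2 h.adj) fun u hu hyu => h.eq_of_adj u hu (adjM_apply_ne_zero.1 hyu)

theorem nullity_skewMatrix_delete_pendant {y x : V} (h : G.underlying.PendantIn W y x) :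
    nullity G.skewMatrix (W \ {y, x}) = nullity G.skewMatrix W :=
  nullity_delete_pendant h.right_mem h.left_mem h.adj.ne' skewMatrix_eq_zero_comm
    (skewMatrix_apply_ne_zero.2 h.adj)
    fun u hu hyu => h.eq_of_adj u hu (skewMatrix_apply_ne_zero.1 hyu)

theorem nullity_eq_of_forall_not_adj (h : ∀ u ∈ W, ∀ v ∈ W, ¬ G.underlying.Adj u v) :
    nullity G.skewMatrix W = nullity G.adjM W := by
  have : ∀ M : Matrix V V ℝ, (∀ u v, M u v ≠ 0 → G.underlying.Adj u v) → ∀ z : V → ℝ,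
      (∀ u ∉ W, z u = 0) → ∀ u ∈ W, M.mulVec z u = 0 := by
    intro M hM z hz u hu
    rw [mulVec_apply_eq_of_forall (z' := 0)]
    · simp
    · intro v hv
      exact hz v fun hvW => h u hu v hvW (hM u v hv)
  have heq : nullOn G.skewMatrix W = nullOn G.adjM W := by
    ext z
    exact ⟨fun hz => ⟨hz.1, this _ (fun u v => adjM_apply_ne_zero.1) z hz.1⟩,
      fun hz => ⟨hz.1, this _ (fun u v => skewMatrix_apply_ne_zero.1) z hz.1⟩⟩
  rw [nullity, nullity, heq]

theorem ncard_delete_lt {v : V} (hv : v ∈ W) : (W \ {v}).ncard < W.ncard :=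
  Set.ncard_sdiff_singleton_lt_of_mem hv

theorem ncard_delete_pair_lt {v u : V} (hv : v ∈ W) : (W \ {v, u}).ncard < W.ncard := by
  refine Set.ncard_lt_ncard ⟨Set.sdiff_subset, fun h => ?_⟩ (Set.toFinite _)
  exact (h hv).2 (by simp)

/-- The bound `r(G) - 2 d(G) ≤ sr(G^σ)` in terms of nullities. -/
theorem nullity_skewMatrix_le (G : OrientedGraph V) (W : Set V) :
    nullity G.skewMatrix W ≤ nullity G.adjM W + 2 * G.underlying.flowDim W := by
  induction hn : W.ncard using Nat.strong_induction_on generalizing W with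
  | _ n ih =>
    subst hn
    by_cases hc : ∃ v, v ∈ G.underlying.flowVerts W
    · obtain ⟨v, hv⟩ := hc
      -- The factor 2 pays for two losses: the skew nullity may fall by one while the adjacency
      -- nullity rises by one.
      have h1 := ih _ (ncard_delete_lt (flowVerts_subset hv)) _ rfl
      have h2 := flowDim_delete_lt hv
      have h3 := nullity_le_delete G.skewMatrix W v
      have h4 := nullity_delete_le G.adjM W v
      omega
    · by_cases he : ∃ u ∈ W, ∃ v ∈ W, G.underlying.Adj u v
      · obtain ⟨u, hu, v, hv, huv⟩ := he
        obtain ⟨y, x, hp⟩ := exists_pendantIn_of_flowVerts_eq_empty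
          (Set.eq_empty_of_forall_notMem fun v hv => hc ⟨v, hv⟩) hu hv huv
        have h1 := ih _ (ncard_delete_pair_lt (u := x) hp.left_mem) _ rfl
        rw [nullity_adjM_delete_pendant hp, nullity_skewMatrix_delete_pendant hp] at h1
        have h2 : G.underlying.flowDim (W \ {y, x}) ≤ G.underlying.flowDim W :=
          flowDim_mono Set.sdiff_subset
        omega
      · push Not at he
        rw [nullity_eq_of_forall_not_adj he]
        omega

variable (G) in
/-- Lower-optimality of the subgraph induced by `W`, in terms of nullities. -/
def LowerOptimalOn (W : Set V) : Prop :=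
  nullity G.skewMatrix W = nullity G.adjM W + 2 * G.underlying.flowDim W

namespace LowerOptimalOn

variable (h : G.LowerOptimalOn W)

-- Equality leaves no slack in the deletion step of the general inequality, so each of its estimates
-- is sharp.
include h in
theorem delete_flowVert {v : V} (hv : v ∈ G.underlying.flowVerts W) :
    G.LowerOptimalOn (W \ {v}) ∧
      G.underlying.flowDim W = G.underlying.flowDim (W \ {v}) + 1 ∧
      nullity G.skewMatrix W = nullity G.skewMatrix (W \ {v}) + 1 ∧
      nullity G.adjM (W \ {v}) = nullity G.adjM W + 1 := by
  have h1 := nullity_skewMatrix_le G (W \ {v})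
  have h2 := flowDim_delete_lt hv
  have h3 := nullity_le_delete G.skewMatrix W v
  have h4 := nullity_delete_le G.adjM W v
  unfold LowerOptimalOn at *
  omega

include h in
theorem delete_pendant {y x : V} (hp : G.underlying.PendantIn W y x) :
    G.LowerOptimalOn (W \ {y, x}) ∧
      G.underlying.flowDim (W \ {y, x}) = G.underlying.flowDim W ∧
      G.underlying.flowVerts (W \ {y, x}) = G.underlying.flowVerts W := by
  have h1 := nullity_skewMatrix_le G (W \ {y, x})
  rw [nullity_adjM_delete_pendant hp, nullity_skewMatrix_delete_pendant hp] at h1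
  have h2 : G.underlying.flowDim (W \ {y, x}) ≤ G.underlying.flowDim W :=
    flowDim_mono Set.sdiff_subset
  have h3 : G.underlying.flowDim (W \ {y, x}) = G.underlying.flowDim W := by
    unfold LowerOptimalOn at h
    omega
  refine ⟨?_, h3, ?_⟩
  · unfold LowerOptimalOn at *
    rw [nullity_adjM_delete_pendant hp, nullity_skewMatrix_delete_pendant hp, h3, h]
  · have : G.underlying.flowOn (W \ {y, x}) = G.underlying.flowOn W :=
      Submodule.eq_of_le_of_finrank_eq (flowOn_mono Set.sdiff_subset) h3
    rw [flowVerts, this, flowVerts]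

/-- Both sides are additive over unjoined parts and the inequality holds on each, so equality for
the union forces equality on the parts. -/
theorem of_union {P Q : Set V} (h : G.LowerOptimalOn (P ∪ Q)) (hd : Disjoint P Q)
    (hPQ : ∀ u ∈ P, ∀ v ∈ Q, ¬ G.underlying.Adj u v) : G.LowerOptimalOn P := by
  have h1 := flowDim_disjoint_union hd hPQ
  have h2 : nullity G.adjM (P ∪ Q) = _ := nullity_disjoint_union hd fun u hu v hv =>
    have h0 : G.adjM u v = 0 := by
      by_contra hne; exact hPQ u hu v hv (adjM_apply_ne_zero.1 hne)
    ⟨h0, (adjM_eq_zero_comm u v).1 h0⟩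
  have h3 : nullity G.skewMatrix (P ∪ Q) = _ := nullity_disjoint_union hd fun u hu v hv =>
    have h0 : G.skewMatrix u v = 0 := by
      by_contra hne; exact hPQ u hu v hv (skewMatrix_apply_ne_zero.1 hne)
    ⟨h0, (skewMatrix_eq_zero_comm u v).1 h0⟩
  have h4 := nullity_skewMatrix_le G P
  have h5 := nullity_skewMatrix_le G Q
  unfold LowerOptimalOn at *
  omega

/-- All edges of a lower-optimal subgraph without pendant vertices carry a flow. -/
def PendantFreeEdgesCarryFlow (G : OrientedGraph V) (W : Set V) : Prop :=
  G.LowerOptimalOn W → (∀ y x, ¬ G.underlying.PendantIn W y x) →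
    ∀ u ∈ W, ∀ v ∈ W, G.underlying.Adj u v → ∃ f ∈ G.underlying.flowOn W, f u v ≠ 0

/-- A lower-optimal subgraph that stays so after deleting a non-isolated vertex `x` off its cycles
has a pendant vertex besides `x`. -/
theorem exists_pendantIn_ne (n : ℕ)
    (ih : ∀ W : Set V, W.ncard < n → PendantFreeEdgesCarryFlow G W)
    {K : Set V} (hK : K.ncard < n) {x w : V} (hx : x ∈ K) (hw : w ∈ K)
    (hxw : G.underlying.Adj x w) (h1 : G.LowerOptimalOn K) (h2 : G.LowerOptimalOn (K \ {x}))
    (hxc : x ∉ G.underlying.flowVerts K) : ∃ y z, y ≠ x ∧ G.underlying.PendantIn K y z := by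
  induction hm : K.ncard using Nat.strong_induction_on generalizing K x w with
  | _ m ihm =>
    subst hm
    by_contra! hc
    -- With no pendant vertex in `K` at all, the edge `xw` would carry a flow, putting `x` on a
    -- cycle.
    have hpx : ∃ w', G.underlying.PendantIn K x w' := by
      by_contra! hnp
      obtain ⟨f, hf, hne⟩ := ih K hK h1 (fun y z hyz => by
        by_cases hyx : y = x
        · exact hnp z (hyx ▸ hyz)
        · exact hc y z hyx hyz) x hx w hw hxw
      exact hxc ⟨f, hf, w, hne⟩
    obtain ⟨w', hp⟩ := hpx
    obtain rfl : w = w' := hp.eq_of_adj w hw hxw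
    have hwx : w ≠ x := hxw.ne'
    obtain ⟨u, hu, hwu, hux⟩ := exists_nbr_ne_of_not_pendantIn hw hx hxw.symm (hc w x hwx)
    obtain ⟨h3, -, h4⟩ := h1.delete_pendant hp
    have hlt := ncard_delete_lt hx
    -- Peel off the pendant `x` and let `w` take its role in `K \ {x}`: deleting `w` as well is a
    -- pendant deletion from `K`. The resulting `y ≠ w` stays pendant in `K` because `w` is the only
    -- neighbour of `x`.
    obtain ⟨y, z, hyw, hyz⟩ := ihm _ hlt (hlt.trans hK) (x := w) (w := u) ⟨hw, hwx⟩ ⟨hu, hux⟩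
      hwu h2 (by
        have : (K \ {x}) \ {w} = K \ {x, w} := by rw [Set.sdiff_sdiff]; rfl
        rwa [this])
      (fun hwc => by
        have := flowVerts_subset (h4 ▸ flowVerts_mono Set.sdiff_subset hwc :
          w ∈ G.underlying.flowVerts (K \ {x, w}))
        exact this.2 (by simp)) rfl
    refine hc y z hyz.left_mem.2 ⟨hyz.left_mem.1, hyz.right_mem.1, hyz.adj, fun t ht hyt => ?_⟩
    refine hyz.eq_of_adj t ⟨ht, fun htx => ?_⟩ hyt
    rw [Set.mem_singleton_iff] at htx
    subst htx
    exact hyw (hp.eq_of_adj y hyz.left_mem.1 hyt.symm)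

/-- A flowless edge leaving a flow vertex `a` is a bridge `ab`. The skew kernel at `a` shows that
`b` is off the cycles of its side `B` and that `B` stays lower-optimal without `b`; then
`exists_pendantIn_ne` finds a pendant vertex that is pendant in `W` too. -/
theorem pendantFreeEdgesCarryFlow (G : OrientedGraph V) (W : Set V) :
    PendantFreeEdgesCarryFlow G W := by
  induction hn : W.ncard using Nat.strong_induction_on generalizing W with
  | _ n ih =>
    subst hn
    intro hLO hnp a₀ ha₀ b₀ hb₀ hab₀
    by_contra! h0
    -- Some flowless edge must touch a flow vertex: otherwise the vertices without flow span a
    -- forest unjoined to the rest, and its leaf is pendant in `W`.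
    obtain ⟨a, b, hac, hb, hab, habf⟩ : ∃ a b, a ∈ G.underlying.flowVerts W ∧ b ∈ W ∧
        G.underlying.Adj a b ∧ ∀ f ∈ G.underlying.flowOn W, f a b = 0 := by
      by_contra! hc
      have hclosed : ∀ u ∈ W, ∀ v ∈ W, G.underlying.Adj u v → u ∉ G.underlying.flowVerts W →
          v ∉ G.underlying.flowVerts W := by
        intro u hu v hv huv hun hvc
        obtain ⟨f, hf, hne⟩ := hc v u hvc hu huv.symm
        exact hun (mem_flowVerts_right hf hne)
      have hnot : ∀ u v, u ∈ W → v ∈ W → G.underlying.Adj u v →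
          (∀ f ∈ G.underlying.flowOn W, f u v = 0) → u ∉ G.underlying.flowVerts W := by
        intro u v hu hv huv hf huc
        obtain ⟨f, hf', hne⟩ := hc u v huc hv huv
        exact hne (hf f hf')
      have ha : a₀ ∉ G.underlying.flowVerts W := hnot a₀ b₀ ha₀ hb₀ hab₀ h0
      have hb : b₀ ∉ G.underlying.flowVerts W := hclosed a₀ ha₀ b₀ hb₀ hab₀ ha
      have hempty : G.underlying.flowVerts (W \ G.underlying.flowVerts W) = ∅ := by
        refine Set.eq_empty_of_forall_notMem fun v hv => ?_
        exact (flowVerts_subset hv).2 (flowVerts_mono Set.sdiff_subset hv)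
      obtain ⟨y, x, hp⟩ := exists_pendantIn_of_flowVerts_eq_empty hempty ⟨ha₀, ha⟩ ⟨hb₀, hb⟩ hab₀
      refine hnp y x ⟨hp.left_mem.1, hp.right_mem.1, hp.adj, fun u hu hyu => ?_⟩
      exact hp.eq_of_adj u ⟨hu, hclosed y hp.left_mem.1 u hu hyu hp.left_mem.2⟩ hyu
    have ha := flowVerts_subset hac
    obtain ⟨B, hBW, hbB, haB, hcut⟩ := exists_side_of_flow_eq_zero ha hb hab habf
    obtain ⟨hLOa, -, hs, -⟩ := hLO.delete_flowVert hac
    have hBlt : B.ncard < W.ncard :=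
      Set.ncard_lt_ncard ⟨hBW, fun h => haB (h ha)⟩ (Set.toFinite _)
    have hLOB : G.LowerOptimalOn B := by
      refine of_union (Q := (W \ {a}) \ B) ?_ Set.disjoint_sdiff_right ?_
      · have hsub : B ⊆ W \ {a} := fun u hu => ⟨hBW hu, fun h => haB (h ▸ hu)⟩
        rwa [Set.union_sdiff_cancel hsub]
      · intro u hu v hv huv
        rcases hcut u hu v hv.1.1 huv with h | h
        · exact hv.2 h
        · exact hv.1.2 h.2
    obtain ⟨z, hz, hza⟩ := exists_mem_nullOn_apply_ne_zero (M := G.skewMatrix) (v := a)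
      (W := W) (by omega)
    -- Only the bridge leaves `B`, so truncating `z` to `B` spoils just row `b`, by the nonzero term
    -- of `z a`. Thus `e_b` is in the column space on `B`.
    have hBb : nullity G.skewMatrix B < nullity G.skewMatrix (B \ {b}) := by
      classical
      have hrow : ∀ u ∈ B, G.skewMatrix.mulVec (B.indicator z) u =
          G.skewMatrix.mulVec z u - (if u = b then G.skewMatrix b a * z a else 0) := by
        intro u hu
        have : G.skewMatrix.mulVec (B.indicator z) u =
            G.skewMatrix.mulVec (z - (if u = b then z a else 0) • Pi.single a 1) u := by
          refine mulVec_apply_eq_of_forall fun v hv => ?_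
          have hadj := skewMatrix_apply_ne_zero.1 hv
          by_cases hvW : v ∈ W
          · rcases hcut u hu v hvW hadj with h | ⟨h1, h2⟩
            · have : v ≠ a := fun e => haB (e ▸ h)
              by_cases hub : u = b <;> simp [h, this, hub]
            · subst h1 h2
              simp [haB]
          · have h1 : v ∉ B := fun h => hvW (hBW h)
            have h2 : v ≠ a := fun e => hvW (e ▸ ha)
            by_cases hub : u = b <;> simp [h1, h2, hz.1 v hvW, hub]
        rw [this, Matrix.mulVec_sub, Matrix.mulVec_smul]
        by_cases hub : u = b
        · subst hub; simp [mul_comm]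
        · simp [hub]
      refine nullity_lt_delete_of_mulVec_eq (x := B.indicator z) skewMatrix_antisymm hbB ?_ ?_ ?_
      · intro u hu; simp [hu]
      · rw [hrow b hbB, hz.2 b (hBW hbB)]
        simpa using ⟨skewMatrix_apply_ne_zero.2 hab.symm, hza⟩
      · intro u hu hub
        rw [hrow u hu, hz.2 u (hBW hu)]
        simp [hub]
    have hbc : b ∉ G.underlying.flowVerts B := by
      intro hbc
      have := (hLOB.delete_flowVert hbc).2.2.1
      omega
    have hdim : G.underlying.flowDim (B \ {b}) = G.underlying.flowDim B := by
      rw [flowDim, flowOn_delete_of_notMem hbc, flowDim]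
    -- The skew nullity rises by at least one, the adjacency nullity by at most one, and the flow
    -- dimension is unchanged.
    have hLOBb : G.LowerOptimalOn (B \ {b}) := by
      have h1 := nullity_skewMatrix_le G (B \ {b})
      have h2 := nullity_delete_le G.adjM B b
      unfold LowerOptimalOn at *
      omega
    obtain ⟨w, hw, hbw, hwa⟩ := exists_nbr_ne_of_not_pendantIn hb ha hab.symm (hnp b a)
    have hwB : w ∈ B := by
      rcases hcut b hbB w hw hbw with h | h
      · exact h
      · exact absurd h.2 hwa
    obtain ⟨y, x, hyb, hp⟩ := exists_pendantIn_ne W.ncard (fun W' hW' => ih _ hW' W' rfl) hBlt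
      hbB hwB hbw hLOB hLOBb hbc
    refine hnp y x ⟨hBW hp.left_mem, hBW hp.right_mem, hp.adj, fun u hu hyu => ?_⟩
    rcases hcut y hp.left_mem u hu hyu with h | h
    · exact hp.eq_of_adj u h hyu
    · exact absurd h.1 hyb

end LowerOptimalOn

end LowerBound

end OrientedGraph

namespace SimpleGraph

/-! ### Cycles as walks, and their transfer to induced subgraphs. -/

section Cycles

variable {V : Type*} {G : SimpleGraph V}

theorem Walk.prod_darts_eq_prod_range {R : Type*} [CommMonoid R] (S : V → V → R) {a b : V}
    (p : G.Walk a b) :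
    (p.darts.map fun d => S d.fst d.snd).prod =
      ∏ i ∈ Finset.range p.length, S (p.getVert i) (p.getVert (i + 1)) := by
  induction p with
  | nil => simp
  | cons h p ih =>
    rw [Walk.darts_cons, List.map_cons, List.prod_cons, ih, Walk.length_cons,
      Finset.prod_range_succ']
    simp [mul_comm]

theorem IsCycleSubgraph.exists_induce {W : Set V} {C : G.Subgraph} (hC : G.IsCycleSubgraph C)
    (hW : C.verts ⊆ W) :
    ∃ C' : (G.induce W).Subgraph, (G.induce W).IsCycleSubgraph C' ∧
      (∀ x, x ∈ C'.verts → (x : V) ∈ C.verts) ∧ ∀ x y : W, C.Adj x y → C'.Adj x y := by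
  obtain ⟨v, c, hc, rfl⟩ := hC
  have hs : ∀ x ∈ c.support, x ∈ W := fun x hx => hW ((c.mem_verts_toSubgraph).2 hx)
  have hmap := c.map_induce hs
  refine ⟨(c.induce W hs).toSubgraph, ⟨_, c.induce W hs, ?_, rfl⟩, fun x hx => ?_,
    fun x y hxy => ?_⟩
  · apply Walk.IsCycle.of_map (f := (Embedding.induce W).toHom)
    rwa [hmap]
  · rw [Walk.mem_verts_toSubgraph] at hx ⊢
    simpa using hx
  · have e : c.toSubgraph = (c.induce W hs).toSubgraph.map (Embedding.induce W).toHom :=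
      (congrArg Walk.toSubgraph hmap).symm.trans
        ((c.induce W hs).toSubgraph_map (Embedding.induce W).toHom)
    rw [e, Subgraph.map_adj] at hxy
    obtain ⟨x', y', h, hx, hy⟩ := hxy
    have h1 : x' = x := Subtype.ext hx
    have h2 : y' = y := Subtype.ext hy
    rwa [h1, h2] at h

theorem IsCycleSubgraph.exists_walk_of_induce {W : Set V} {C : (G.induce W).Subgraph}
    (hC : (G.induce W).IsCycleSubgraph C) :
    ∃ (v : V) (c : G.Walk v v), c.IsCycle ∧
      (∀ x, x ∈ c.support ↔ ∃ h : x ∈ W, (⟨x, h⟩ : W) ∈ C.verts) ∧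
      ∀ x y : W, C.Adj x y → c.toSubgraph.Adj x y := by
  obtain ⟨v, c, hc, rfl⟩ := hC
  refine ⟨_, c.map (Embedding.induce W).toHom, ?_, fun x => ?_, fun x y h => ?_⟩
  · exact (Walk.isCycle_map_iff_of_injective Subtype.val_injective).2 hc
  · rw [Walk.support_map, List.mem_map]
    constructor
    · rintro ⟨y, hy, rfl⟩
      exact ⟨y.2, (c.mem_verts_toSubgraph).2 hy⟩
    · rintro ⟨h, hx⟩
      exact ⟨⟨x, h⟩, (c.mem_verts_toSubgraph).1 hx, rfl⟩
  · rw [Walk.toSubgraph_map, Subgraph.map_adj]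
    exact ⟨x, y, h, rfl, rfl⟩

theorem PendantIn.deltaStep {W : Set V} {H : SimpleGraph V} {y x : V}
    (hp : H.PendantIn W y x) : H.DeltaStep W (W \ {y, x}) := by
  refine ⟨⟨y, hp.left_mem⟩, ⟨x, hp.right_mem⟩, ?_, hp.adj, rfl⟩
  rw [IsPendant, Set.ncard_eq_one]
  refine ⟨⟨x, hp.right_mem⟩, ?_⟩
  ext u
  rw [mem_neighborSet, Set.mem_singleton_iff]
  refine ⟨fun hu => Subtype.ext (hp.eq_of_adj u u.2 hu), ?_⟩
  rintro rfl
  exact hp.adj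

/-- A cycle all of whose vertices have in `W` only their neighbours on the cycle. -/
def Walk.IsIsolatedIn {v : V} (c : G.Walk v v) (W : Set V) : Prop :=
  ∀ u ∈ c.support, ∀ w ∈ W, G.Adj u w → c.toSubgraph.Adj u w

end Cycles

/-! ### Recurrences satisfied by kernel vectors along a cycle. -/

section Sequences

/-- The two halves of a sequence with `ζ (i + 2) = - ζ i` along a path. -/
theorem alternating_apply {ζ : ℕ → ℝ} {q : ℕ} (h : ∀ i, i + 1 < q → ζ (i + 2) = - ζ i) (r j : ℕ)
    (hj : 2 * j + r ≤ q) : ζ (2 * j + r) = (-1) ^ j * ζ r := by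
  induction j with
  | zero => simp
  | succ j ih =>
    have := h (2 * j + r) (by omega)
    rw [show 2 * (j + 1) + r = 2 * j + r + 2 by ring, this, ih (by omega), pow_succ]
    ring

/-- For odd `q` the zeros at the two ends propagate to `ζ (q - 1)` and `ζ 1`; for `4 ∣ q`, an odd
number of sign changes gives `ζ (q - 1) = - ζ 1`. -/
theorem mod_four_eq_two_of_alternating {ζ : ℕ → ℝ} {q : ℕ} (hq : 3 ≤ q)
    (h : ∀ i, i + 1 < q → ζ (i + 2) = - ζ i) (h0 : ζ 0 = 0) (h1 : ζ q = 0)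
    (h2 : ζ 1 + ζ (q - 1) ≠ 0) : q % 4 = 2 := by
  rcases Nat.even_or_odd' q with ⟨m, rfl | rfl⟩
  · rcases Nat.even_or_odd' m with ⟨t, rfl | rfl⟩
    · exfalso
      apply h2
      have := alternating_apply h 1 (2 * t - 1) (by omega)
      rw [show 2 * (2 * t) - 1 = 2 * (2 * t - 1) + 1 by omega, this,
        Odd.neg_one_pow ⟨t - 1, by omega⟩]
      ring
    · omega
  · exfalso
    apply h2
    have e1 := alternating_apply h 1 m (by omega)
    have e2 := alternating_apply h 0 m (by omega)
    rw [h1] at e1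
    have hz : ζ 1 = 0 := by
      have : (-1 : ℝ) ^ m ≠ 0 := by simp
      simpa [this] using e1.symm
    rw [h0, mul_zero] at e2
    rw [show 2 * m + 1 - 1 = 2 * m + 0 by omega, e2, hz, add_zero]

/-- Here `q / 2` is odd: going round gives `ζ q = - ζ 0` and `ζ (q - 1) = ζ 1`, so the closing
conditions kill both parity classes. -/
theorem eq_zero_of_alternating {ζ : ℕ → ℝ} {q : ℕ} (hq : q % 4 = 2)
    (h : ∀ i, i + 1 < q → ζ (i + 2) = - ζ i) (h0 : ζ q = ζ 0)
    (h2 : ζ 1 + ζ (q - 1) = 0) {i : ℕ} (hi : i ≤ q) : ζ i = 0 := by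
  obtain ⟨m, rfl⟩ : ∃ m, q = 2 * (2 * m + 1) + 0 := ⟨q / 4, by omega⟩
  have e0 := alternating_apply h 0 (2 * m + 1) le_rfl
  have e1 := alternating_apply h 1 (2 * m) (by omega)
  rw [h0, Odd.neg_one_pow ⟨m, rfl⟩] at e0
  have z0 : ζ 0 = 0 := by linarith
  rw [show 2 * (2 * m + 1) + 0 - 1 = 2 * (2 * m) + 1 by omega, e1, Even.neg_one_pow ⟨m, by ring⟩]
    at h2
  have z1 : ζ 1 = 0 := by linarith
  rcases Nat.even_or_odd' i with ⟨j, rfl | rfl⟩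
  · have := alternating_apply h 0 j (by omega)
    simpa [z0] using this
  · rw [alternating_apply h 1 j (by omega), z1, mul_zero]

/-- As `s (i + 1)` is its own inverse, two steps multiply by `s i * s (i + 1)`. -/
theorem apply_eq_prod_mul {ζ s : ℕ → ℝ} {q : ℕ} (hs : ∀ i < q, s i * s i = 1)
    (h : ∀ i, i + 1 < q → s (i + 1) * ζ (i + 2) = s i * ζ i) (j : ℕ) (hj : 2 * j ≤ q) :
    ζ (2 * j) = (∏ i ∈ Finset.range (2 * j), s i) * ζ 0 := by
  induction j with
  | zero => simp
  | succ j ih =>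
    have h1 := h (2 * j) (by omega)
    have h2 := hs (2 * j + 1) (by omega)
    rw [show 2 * (j + 1) = 2 * j + 1 + 1 by ring, Finset.prod_range_succ, Finset.prod_range_succ]
    calc ζ (2 * j + 1 + 1) = s (2 * j + 1) * (s (2 * j + 1) * ζ (2 * j + 2)) := by
          rw [← mul_assoc, h2, one_mul]
      _ = _ := by rw [h1, ih (by omega)]; ring

end Sequences

end SimpleGraph

namespace OrientedGraph

open SimpleGraph

/-! ### Matrix rows at the vertices of an isolated cycle. -/

section CycleRows

variable {V : Type*} [Fintype V] {G : SimpleGraph V} {W : Set V} {M : Matrix V V ℝ}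

theorem mulVec_apply_eq_add {z : V → ℝ} (hz : ∀ u ∉ W, z u = 0) {u p q : V} (hpq : p ≠ q)
    (h : ∀ w ∈ W, M u w ≠ 0 → w = p ∨ w = q) :
    M.mulVec z u = M u p * z p + M u q * z q := by
  classical
  simp only [Matrix.mulVec, dotProduct]
  rw [← Finset.sum_pair (f := fun w => M u w * z w) hpq]
  refine (Finset.sum_subset (Finset.subset_univ _) fun w _ hw => ?_).symm
  by_cases hwW : w ∈ W
  · by_contra hne
    exact hw (by simpa using h w hwW (left_ne_zero_of_mul hne))
  · rw [hz w hwW, mul_zero]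

variable (hM : ∀ u w, M u w ≠ 0 → G.Adj u w) {v : V} {c : G.Walk v v} (hc : c.IsCycle)
  (hiso : c.IsIsolatedIn W) {z : V → ℝ} (hz : ∀ u ∉ W, z u = 0)

include hM hc hiso hz

theorem mulVec_getVert_succ {i : ℕ} (hi : i + 1 < c.length) :
    M.mulVec z (c.getVert (i + 1)) =
      M (c.getVert (i + 1)) (c.getVert i) * z (c.getVert i) +
      M (c.getVert (i + 1)) (c.getVert (i + 2)) * z (c.getVert (i + 2)) := by
  refine mulVec_apply_eq_add hz (hc.getVert_sub_one_ne_getVert_add_one hi.le) fun w hw hne => ?_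
  have : w ∈ c.toSubgraph.neighborSet (c.getVert (i + 1)) :=
    hiso _ (c.getVert_mem_support _) w hw (hM _ _ hne)
  rw [hc.neighborSet_toSubgraph_internal (Nat.succ_ne_zero i) hi] at this
  simpa using this

theorem mulVec_start :
    M.mulVec z v = M v (c.getVert 1) * z (c.getVert 1) +
      M v (c.getVert (c.length - 1)) * z (c.getVert (c.length - 1)) := by
  refine mulVec_apply_eq_add hz hc.snd_ne_penultimate fun w hw hne => ?_
  have : w ∈ c.toSubgraph.neighborSet v :=
    hiso _ (c.start_mem_support) w hw (hM _ _ hne)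
  rw [hc.neighborSet_toSubgraph_endpoint] at this
  simpa using this

end CycleRows

/-! ### Necessity of the three conditions. -/

section Necessity

variable {V : Type*} [Fintype V] {G : OrientedGraph V} {W : Set V}

namespace LowerOptimalOn

variable (h : G.LowerOptimalOn W)
include h

/-- Flows are proportional at `u`, so every flow there is a multiple of the flow of `c` and uses
only edges of `c`. -/
theorem flow_imp_mem_edges {v : V} {c : G.underlying.Walk v v} (hc : c.IsCycle)
    (hW : ∀ u ∈ c.support, u ∈ W) {f : V → V → ℝ} (hf : f ∈ G.underlying.flowOn W) {u w : V}
    (hu : u ∈ c.support) (huw : f u w ≠ 0) : c.toSubgraph.Adj u w := by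
  have huc := hc.mem_flowVerts hW hu
  have hne : (c.toSubgraph.neighborSet u).Nonempty := by
    rw [← Set.ncard_pos, hc.ncard_neighborSet_toSubgraph_eq_two hu]
    norm_num
  obtain ⟨t, ht⟩ := hne
  obtain ⟨k, hk⟩ := exists_sub_smul_mem_flowOn_delete (h.delete_flowVert huc).2.1.le
    (walkFlow_mem_flowOn c hW)
    (hc.isTrail.walkFlow_ne_zero (Walk.adj_toSubgraph_iff_mem_edges.1 ht)) hf
  have h0 := apply_eq_zero_of_mem_flowOn_delete hk w
  rw [Walk.adj_toSubgraph_iff_mem_edges]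
  refine mem_edges_of_walkFlow_ne_zero fun hz => huw ?_
  simpa [hz] using h0

theorem toSubgraph_le {a b : V} {c : G.underlying.Walk a a} {d : G.underlying.Walk b b}
    (hc : c.IsCycle) (hd : d.IsCycle) (hcW : ∀ u ∈ c.support, u ∈ W)
    (hdW : ∀ u ∈ d.support, u ∈ W) {v : V} (hvc : v ∈ c.support) (hvd : v ∈ d.support) :
    c.toSubgraph ≤ d.toSubgraph := by
  have step : ∀ x y, x ∈ d.support → c.toSubgraph.Adj x y → d.toSubgraph.Adj x y := by
    intro x y hx hxy
    exact h.flow_imp_mem_edges hd hdW (walkFlow_mem_flowOn c hcW) hx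
      (hc.isTrail.walkFlow_ne_zero (Walk.adj_toSubgraph_iff_mem_edges.1 hxy))
  have step' : ∀ x y, x ∈ d.support → c.toSubgraph.Adj x y → y ∈ d.support := by
    intro x y hx hxy
    exact (d.mem_verts_toSubgraph).1 (step x y hx hxy).snd_mem
  obtain ⟨n, hn, hnl⟩ := Walk.mem_support_iff_exists_getVert.1 hvc
  -- From the common vertex `c.getVert n`, go back along `c` to its base point, then forward over
  -- all of `c`.
  have hdown : ∀ k ≤ n, c.getVert (n - k) ∈ d.support := by
    intro k hk
    induction k with
    | zero => simpa [hn] using hvd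
    | succ k ih =>
      refine step' _ _ (ih (by omega)) ?_
      have := c.toSubgraph_adj_getVert (i := n - (k + 1)) (by omega)
      rw [show n - (k + 1) + 1 = n - k by omega] at this
      exact this.symm
  have hup : ∀ i ≤ c.length, c.getVert i ∈ d.support := by
    intro i hi
    induction i with
    | zero => simpa using hdown n le_rfl
    | succ i ih => exact step' _ _ (ih (by omega)) (c.toSubgraph_adj_getVert (by omega))
  have hall : ∀ x ∈ c.support, x ∈ d.support := by
    intro x hx
    obtain ⟨i, rfl, hi⟩ := Walk.mem_support_iff_exists_getVert.1 hx
    exact hup i hi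
  refine ⟨fun x hx => ?_, fun x y hxy => ?_⟩
  · rw [Walk.mem_verts_toSubgraph] at hx ⊢
    exact hall x hx
  · exact step x y (hall x ((c.mem_verts_toSubgraph).1 hxy.fst_mem)) hxy

theorem disjoint_of_ne {C D : G.underlying.Subgraph} (hC : G.underlying.IsCycleSubgraph C)
    (hD : G.underlying.IsCycleSubgraph D) (hCW : C.verts ⊆ W) (hDW : D.verts ⊆ W) (hne : C ≠ D) :
    Disjoint C.verts D.verts := by
  obtain ⟨a, c, hc, rfl⟩ := hC
  obtain ⟨b, d, hd, rfl⟩ := hD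
  rw [Set.disjoint_left]
  intro v hvc hvd
  rw [Walk.mem_verts_toSubgraph] at hvc hvd
  have hcW : ∀ u ∈ c.support, u ∈ W := fun u hu => hCW ((c.mem_verts_toSubgraph).2 hu)
  have hdW : ∀ u ∈ d.support, u ∈ W := fun u hu => hDW ((d.mem_verts_toSubgraph).2 hu)
  exact hne (le_antisymm (h.toSubgraph_le hc hd hcW hdW hvc hvd)
    (h.toSubgraph_le hd hc hdW hcW hvd hvc))

/-- The cycles of a lower-optimal subgraph without pendant vertices have no further neighbours. -/
theorem isIsolatedIn (hnp : ∀ y x, ¬ G.underlying.PendantIn W y x) {v : V}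
    {c : G.underlying.Walk v v} (hc : c.IsCycle) (hW : ∀ u ∈ c.support, u ∈ W) :
    c.IsIsolatedIn W := by
  intro u hu w hw huw
  obtain ⟨f, hf, hne⟩ := pendantFreeEdgesCarryFlow G W h hnp u (hW u hu) w hw huw
  exact h.flow_imp_mem_edges hc hW hf hu hne

/-- Deleting `v` raises the adjacency nullity, so some kernel vector off `v` fails row `v`. Along
the cycle it alternates, vanishes at both ends and violates the closing condition. -/
theorem length_mod_four_of_isIsolatedIn {v : V} {c : G.underlying.Walk v v} (hc : c.IsCycle)
    (hW : ∀ u ∈ c.support, u ∈ W) (hiso : c.IsIsolatedIn W) : c.length % 4 = 2 := by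
  have hv := hc.mem_flowVerts hW c.start_mem_support
  obtain ⟨z, hz, hzv⟩ := exists_mem_nullOn_mulVec_ne_zero (M := G.adjM) (W := W) (v := v)
    (by have := (h.delete_flowVert hv).2.2.2; omega)
  have hM : ∀ u w, G.adjM u w ≠ 0 → G.underlying.Adj u w := fun _ _ => adjM_apply_ne_zero.1
  have hz0 : ∀ u ∉ W, z u = 0 := fun u hu => hz.1 u fun h' => hu h'.1
  have h3 := hc.three_le_length
  have hzs : z v = 0 := hz.1 v (by simp)
  refine mod_four_eq_two_of_alternating (ζ := fun i => z (c.getVert i)) h3 (fun i hi => ?_)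
    (by simpa using hzs) (by simpa using hzs) ?_
  · have hne : c.getVert (i + 1) ≠ v := by
      rw [Ne, hc.getVert_endpoint_iff hi.le]; omega
    have hrow := mulVec_getVert_succ hM hc hiso hz0 hi
    rw [hz.2 _ ⟨hW _ (c.getVert_mem_support _), hne⟩,
      adjM_apply_eq_one (c.adj_getVert_succ (by omega)).symm,
      adjM_apply_eq_one (c.adj_getVert_succ hi)] at hrow
    show z (c.getVert (i + 2)) = - z (c.getVert i)
    linarith
  · have hrow := mulVec_start hM hc hiso hz0
    rw [adjM_apply_eq_one (c.adj_snd hc.not_nil),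
      adjM_apply_eq_one (c.adj_penultimate hc.not_nil).symm, one_mul, one_mul] at hrow
    rwa [hrow] at hzv

/-- Deleting `v` lowers the skew nullity, so some kernel vector is nonzero at `v`. Carried round the
even cycle, its value at `v` is multiplied by the sign product, which must be 1. -/
theorem evenlyOriented_of_isIsolatedIn {v : V} {c : G.underlying.Walk v v} (hc : c.IsCycle)
    (hW : ∀ u ∈ c.support, u ∈ W) (hiso : c.IsIsolatedIn W) : G.EvenlyOriented c := by
  have hmod := h.length_mod_four_of_isIsolatedIn hc hW hiso
  obtain ⟨m, hm⟩ : ∃ m, c.length = 2 * m := ⟨c.length / 2, by omega⟩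
  refine ⟨⟨m, by omega⟩, ?_⟩
  refine lt_of_lt_of_eq ?_ (Walk.prod_darts_eq_prod_range G.skewMatrix c).symm
  have hv := hc.mem_flowVerts hW c.start_mem_support
  obtain ⟨z, hz, hzv⟩ := exists_mem_nullOn_apply_ne_zero (M := G.skewMatrix) (W := W) (v := v)
    (by have := (h.delete_flowVert hv).2.2.1; omega)
  have hM : ∀ u w, G.skewMatrix u w ≠ 0 → G.underlying.Adj u w :=
    fun _ _ => skewMatrix_apply_ne_zero.1
  have key := apply_eq_prod_mul (ζ := fun i => z (c.getVert i))
    (s := fun i => G.skewMatrix (c.getVert i) (c.getVert (i + 1))) (q := c.length)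
    (fun i hi => skewMatrix_mul_self (c.adj_getVert_succ hi)) (fun i hi => by
      have hrow := mulVec_getVert_succ hM hc hiso hz.1 hi
      rw [hz.2 _ (hW _ (c.getVert_mem_support _)),
        skewMatrix_antisymm (c.getVert i) (c.getVert (i + 1))] at hrow
      show G.skewMatrix (c.getVert (i + 1)) (c.getVert (i + 2)) * z (c.getVert (i + 2)) =
        G.skewMatrix (c.getVert i) (c.getVert (i + 1)) * z (c.getVert i)
      linarith) m hm.ge
  simp only [← hm, Walk.getVert_length, Walk.getVert_zero] at key
  have : (∏ i ∈ Finset.range c.length, G.skewMatrix (c.getVert i) (c.getVert (i + 1))) = 1 :=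
    mul_right_cancel₀ hzv (by rw [← key, one_mul])
  rw [this]
  exact one_pos

-- Pendant deletions keep the flow vertices, so the cycle survives until no pendant vertex is left
-- and it is isolated.
omit h in
theorem cycle_condition (h : G.LowerOptimalOn W) {v : V} {c : G.underlying.Walk v v}
    (hc : c.IsCycle) (hW : ∀ u ∈ c.support, u ∈ W) :
    G.EvenlyOriented c ∧ c.length ≡ 2 [MOD 4] := by
  induction hn : W.ncard using Nat.strong_induction_on generalizing W with
  | _ n ih =>
    subst hn
    by_cases hp : ∃ y x, G.underlying.PendantIn W y x
    · obtain ⟨y, x, hp⟩ := hp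
      obtain ⟨h1, -, h3⟩ := h.delete_pendant hp
      refine ih _ (ncard_delete_pair_lt (u := x) hp.left_mem) h1 (fun u hu => ?_) rfl
      exact flowVerts_subset (h3 ▸ hc.mem_flowVerts hW hu)
    · push Not at hp
      have hiso := h.isIsolatedIn hp hc hW
      exact ⟨h.evenlyOriented_of_isIsolatedIn hc hW hiso,
        h.length_mod_four_of_isIsolatedIn hc hW hiso⟩

omit h in
theorem exists_reduction (h : G.LowerOptimalOn W) :
    ∃ W', Relation.ReflTransGen G.underlying.DeltaStep W W' ∧ G.LowerOptimalOn W' ∧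
      G.underlying.flowDim W' = G.underlying.flowDim W ∧
      ∀ y x, ¬ G.underlying.PendantIn W' y x := by
  induction hn : W.ncard using Nat.strong_induction_on generalizing W with
  | _ n ih =>
    subst hn
    by_cases hp : ∃ y x, G.underlying.PendantIn W y x
    · obtain ⟨y, x, hp⟩ := hp
      obtain ⟨h1, h2, -⟩ := h.delete_pendant hp
      obtain ⟨W', h3, h4, h5, h6⟩ := ih _ (ncard_delete_pair_lt (u := x) hp.left_mem) h1 rfl
      exact ⟨W', Relation.ReflTransGen.head hp.deltaStep h3, h4, h5.trans h2, h6⟩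
    · push Not at hp
      exact ⟨W, Relation.ReflTransGen.refl, h, rfl, hp⟩

-- Cutting a cycle at one vertex lowers the flow dimension by one. Cycles found afterwards miss that
-- vertex, hence differ from the first and are disjoint from it; any flow is a multiple of the first
-- cycle plus a flow of the rest.
omit h in
theorem exists_cycles (k : ℕ) (h : G.LowerOptimalOn W) (hk : G.underlying.flowDim W = k) :
    ∃ C : Fin k → G.underlying.Subgraph, (∀ i, G.underlying.IsCycleSubgraph (C i)) ∧
      (∀ i, (C i).verts ⊆ W) ∧ (∀ i j, i ≠ j → Disjoint (C i).verts (C j).verts) ∧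
      ∀ f ∈ G.underlying.flowOn W, ∀ u v, f u v ≠ 0 → ∃ i, (C i).Adj u v := by
  induction k generalizing W with
  | zero =>
    refine ⟨Fin.elim0, fun i => i.elim0, fun i => i.elim0, fun i => i.elim0, fun f hf u v huv => ?_⟩
    have : G.underlying.flowOn W = ⊥ := Submodule.finrank_eq_zero.1 hk
    rw [this, Submodule.mem_bot] at hf
    simp [hf] at huv
  | succ k ih =>
    have hne : ∃ f ∈ G.underlying.flowOn W, ∃ a b, f a b ≠ 0 := by
      by_contra! hz
      have : G.underlying.flowOn W = ⊥ := by
        rw [eq_bot_iff]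
        intro f hf
        rw [Submodule.mem_bot]
        ext a b
        exact hz f hf a b
      rw [flowDim, this, finrank_bot] at hk
      omega
    obtain ⟨f, hf, a, b, hab⟩ := hne
    obtain ⟨v, c, hc, hcW⟩ := exists_isCycle_of_flow_ne_zero hf hab
    have hv := hc.mem_flowVerts hcW c.start_mem_support
    obtain ⟨h1, h2, -⟩ := h.delete_flowVert hv
    obtain ⟨C, hC1, hC2, hC3, hC4⟩ := ih h1 (by omega)
    have hcC : G.underlying.IsCycleSubgraph c.toSubgraph := ⟨v, c, hc, rfl⟩
    have hcV : c.toSubgraph.verts ⊆ W := fun u hu => hcW u ((c.mem_verts_toSubgraph).1 hu)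
    have hdis : ∀ i, Disjoint c.toSubgraph.verts (C i).verts := by
      intro i
      refine h.disjoint_of_ne hcC (hC1 i) hcV (fun u hu => (hC2 i hu).1) fun heq => ?_
      have : v ∈ (C i).verts := heq ▸ c.start_mem_verts_toSubgraph
      exact (hC2 i this).2 rfl
    refine ⟨Fin.cons c.toSubgraph C, ?_, ?_, ?_, ?_⟩
    · intro i
      refine Fin.cases ?_ (fun i => ?_) i
      · simpa using hcC
      · simpa using hC1 i
    · intro i
      refine Fin.cases ?_ (fun i => ?_) i
      · simpa using hcV
      · rw [Fin.cons_succ]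
        exact fun u hu => (hC2 i hu).1
    · intro i j
      refine Fin.cases ?_ (fun i => ?_) i <;> refine Fin.cases ?_ (fun j => ?_) j
      · intro hij; exact absurd rfl hij
      · intro _; simpa using hdis j
      · intro _; simpa using (hdis i).symm
      · intro hij
        simpa using hC3 i j fun e => hij (by rw [e])
    · intro g hg x y hxy
      obtain ⟨k', hk'⟩ := exists_sub_smul_mem_flowOn_delete h2.le (walkFlow_mem_flowOn c hcW)
        (hc.isTrail.walkFlow_ne_zero (Walk.adj_toSubgraph_iff_mem_edges.1
          (c.toSubgraph_adj_snd hc.not_nil))) hg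
      by_cases hcx : walkFlow c x y = 0
      · obtain ⟨i, hi⟩ := hC4 _ hk' x y (by simpa [hcx] using hxy)
        exact ⟨i.succ, by simpa using hi⟩
      · exact ⟨0, by
          simpa using Walk.adj_toSubgraph_iff_mem_edges.2 (mem_edges_of_walkFlow_ne_zero hcx)⟩

omit h in
theorem exists_isDisjointCyclesWithIsolated (h : G.LowerOptimalOn W) :
    ∃ W', Relation.ReflTransGen G.underlying.DeltaStep W W' ∧
      (G.underlying.induce W').IsDisjointCyclesWithIsolated (G.underlying.flowDim W) := by
  obtain ⟨W', h1, h2, h3, h4⟩ := h.exists_reduction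
  obtain ⟨C, hC1, hC2, hC3, hC4⟩ := h2.exists_cycles _ h3
  choose C' hC' hverts hadj using fun i => (hC1 i).exists_induce (hC2 i)
  refine ⟨W', h1, C', hC', fun i j hij => ?_, fun u v huv => ?_⟩
  · rw [Set.disjoint_left]
    exact fun x hxi hxj => Set.disjoint_left.1 (hC3 i j hij) (hverts i x hxi) (hverts j x hxj)
  · obtain ⟨f, hf, hne⟩ := pendantFreeEdgesCarryFlow G W' h2 h4 u u.2 v v.2 huv
    obtain ⟨i, hi⟩ := hC4 f hf u v hne
    exact ⟨i, hadj i u v hi⟩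

end LowerOptimalOn

end Necessity

end OrientedGraph

namespace OrientedGraph

open SimpleGraph

/-! ### Sufficiency: contributions of good cycles to the nullities. -/

section Sufficiency

variable {V : Type*}

open Classical in
/-- The vector with value `α i` at the `i`-th vertex of a cycle. -/
noncomputable def cycleVector {H : SimpleGraph V} {v : V} (c : H.Walk v v) (α : ℕ → ℝ) : V → ℝ :=
  ∑ i ∈ Finset.range c.length, α i • Pi.single (c.getVert i) 1

/-- The sum counts the base point only at position 0; `hα` extends the formula to position
`c.length`. -/
theorem cycleVector_getVert {H : SimpleGraph V} {v : V} {c : H.Walk v v} (hc : c.IsCycle)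
    {α : ℕ → ℝ} (hα : α c.length = α 0) {i : ℕ} (hi : i ≤ c.length) :
    cycleVector c α (c.getVert i) = α i := by
  classical
  have h3 := hc.three_le_length
  have key : ∀ i < c.length, cycleVector c α (c.getVert i) = α i := by
    intro i hi
    rw [cycleVector, Finset.sum_apply, Finset.sum_eq_single_of_mem i (Finset.mem_range.2 hi)]
    · simp
    · intro j hj hji
      rw [Finset.mem_range] at hj
      have hne : c.getVert i ≠ c.getVert j := by
        intro e
        exact hji (hc.getVert_injOn' (Set.mem_ofPred_eq ▸ by omega)
          (Set.mem_ofPred_eq ▸ by omega) e).symm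
      simp [hne]
  rcases hi.lt_or_eq with h | rfl
  · exact key i h
  · have := key 0 (by omega)
    rw [c.getVert_zero] at this
    rw [c.getVert_length, this, hα]

theorem cycleVector_apply_of_notMem {H : SimpleGraph V} {v : V} {c : H.Walk v v} {α : ℕ → ℝ}
    {u : V} (hu : u ∉ c.support) : cycleVector c α u = 0 := by
  classical
  rw [cycleVector, Finset.sum_apply]
  refine Finset.sum_eq_zero fun i _ => ?_
  have : u ≠ c.getVert i := fun e => hu (e ▸ c.getVert_mem_support i)
  simp [this]

variable [Fintype V] {G : OrientedGraph V} {W : Set V} {v : V} {c : G.underlying.Walk v v}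

/-- `h1` gives the rows at inner vertices and `h2` the row at the base point, with the backward
entry turned round by skewness. -/
theorem cycleVector_mem_nullOn (hc : c.IsCycle) (hW : ∀ u ∈ c.support, u ∈ W)
    (hiso : c.IsIsolatedIn W) {α : ℕ → ℝ} (h0 : α c.length = α 0)
    (h1 : ∀ i, i + 1 < c.length → G.skewMatrix (c.getVert (i + 1)) (c.getVert (i + 2)) * α (i + 2) =
      G.skewMatrix (c.getVert i) (c.getVert (i + 1)) * α i)
    (h2 : G.skewMatrix v (c.getVert 1) * α 1 =
      G.skewMatrix (c.getVert (c.length - 1)) v * α (c.length - 1)) :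
    cycleVector c α ∈ nullOn G.skewMatrix W := by
  have h3 := hc.three_le_length
  have hM : ∀ u w, G.skewMatrix u w ≠ 0 → G.underlying.Adj u w :=
    fun _ _ => skewMatrix_apply_ne_zero.1
  have hz : ∀ u ∉ W, cycleVector c α u = 0 :=
    fun u hu => cycleVector_apply_of_notMem fun h => hu (hW u h)
  have hstart : G.skewMatrix.mulVec (cycleVector c α) v = 0 := by
    rw [mulVec_start hM hc hiso hz, cycleVector_getVert hc h0 (by omega),
      cycleVector_getVert hc h0 (by omega), skewMatrix_antisymm (c.getVert (c.length - 1)) v]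
    linarith
  refine ⟨hz, fun u hu => ?_⟩
  by_cases huc : u ∈ c.support
  · obtain ⟨i, rfl, hi⟩ := Walk.mem_support_iff_exists_getVert.1 huc
    rcases i with _ | i
    · rwa [c.getVert_zero]
    · rcases hi.lt_or_eq with hi | hi
      · rw [mulVec_getVert_succ hM hc hiso hz hi, cycleVector_getVert hc h0 (by omega),
          cycleVector_getVert hc h0 (by omega),
          skewMatrix_antisymm (c.getVert i) (c.getVert (i + 1))]
        have := h1 i hi
        linarith
      · rwa [hi, c.getVert_length]
  · rw [mulVec_apply_eq_of_forall (z' := 0)]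
    · simp
    · intro w hw
      refine cycleVector_apply_of_notMem fun hwc => huc ?_
      exact (c.mem_verts_toSubgraph).1 (hiso w hwc u hu (hM u w hw).symm).snd_mem

/-- Removing an isolated evenly-oriented cycle lowers the skew nullity by at least two. -/
theorem nullity_skewMatrix_delete_cycle (hc : c.IsCycle) (hW : ∀ u ∈ c.support, u ∈ W)
    (hiso : c.IsIsolatedIn W) (hev : G.EvenlyOriented c) :
    nullity G.skewMatrix (W \ {u | u ∈ c.support}) + 2 ≤ nullity G.skewMatrix W := by
  have h3 := hc.three_le_length
  let s : ℕ → ℝ := fun i => G.skewMatrix (c.getVert i) (c.getVert (i + 1))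
  let P : ℕ → ℝ := fun i => ∏ t ∈ Finset.range i, s t
  have hs : ∀ i < c.length, s i * s i = 1 := fun i hi => skewMatrix_mul_self (c.adj_getVert_succ hi)
  have hP : ∀ i, P (i + 1) = P i * s i := fun i => Finset.prod_range_succ _ _
  have hPsq : ∀ i ≤ c.length, P i * P i = 1 := by
    intro i hi
    induction i with
    | zero => simp [P]
    | succ i ih =>
      rw [hP]
      calc P i * s i * (P i * s i) = (P i * P i) * (s i * s i) := by ring
        _ = 1 := by rw [ih (by omega), hs i (by omega), one_mul]
  -- Even orientation makes the full product positive, and its square is 1.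
  have hPq : P c.length = 1 := by
    have hpos : 0 < P c.length :=
      lt_of_lt_of_eq hev.2 (Walk.prod_darts_eq_prod_range G.skewMatrix c)
    nlinarith [hPsq c.length le_rfl]
  have hstep : ∀ i, i + 1 < c.length → s (i + 1) * P (i + 2) = s i * P i := by
    intro i hi
    rw [hP (i + 1), hP i]
    calc s (i + 1) * (P i * s i * s (i + 1)) = (s (i + 1) * s (i + 1)) * (s i * P i) := by ring
      _ = _ := by rw [hs _ hi, one_mul]
  have hlast : s (c.length - 1) * P (c.length - 1) = 1 := by
    rw [mul_comm, ← hP, show c.length - 1 + 1 = c.length by omega, hPq]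
  have hs' : G.skewMatrix (c.getVert (c.length - 1)) v = s (c.length - 1) := by
    simp only [s]
    rw [show c.length - 1 + 1 = c.length by omega, c.getVert_length]
  have hs0 : G.skewMatrix v (c.getVert 1) = s 0 := by simp [s]
  have hP0 : P 0 = 1 := by simp [P]
  have hP1 : P 1 = s 0 := by simp [P]
  -- The partial products solve the row recurrence. Rows link only positions of equal parity, and
  -- the length is even, so the even and odd halves are separate kernel vectors.
  let α : ℕ → ℝ := fun i => if Even i then P i else 0
  let β : ℕ → ℝ := fun i => if Even i then 0 else P i
  have hodd : ¬ Even (c.length - 1) := by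
    rw [Nat.not_even_iff_odd]
    exact Nat.Even.sub_odd (by omega) hev.1 odd_one
  have hα0 : α c.length = α 0 := by simp [α, hev.1, hPq, hP0]
  have hβ0 : β c.length = β 0 := by simp [β, hev.1]
  have hα : cycleVector c α ∈ nullOn G.skewMatrix W := by
    refine cycleVector_mem_nullOn hc hW hiso hα0 (fun i hi => ?_) ?_
    · by_cases he : Even i
      · simpa [α, he, Nat.even_add] using hstep i hi
      · simp [α, he, Nat.even_add]
    · simp [α, hodd]
  have hβ : cycleVector c β ∈ nullOn G.skewMatrix W := by
    refine cycleVector_mem_nullOn hc hW hiso hβ0 (fun i hi => ?_) ?_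
    · by_cases he : Even i
      · simp [β, he, Nat.even_add]
      · simpa [β, he, Nat.even_add] using hstep i hi
    · rw [hs', hs0]
      simp only [β, hodd, if_false, hlast, Nat.not_even_one, hP1]
      exact hs 0 (by omega)
  have hsub : ∀ z ∈ nullOn G.skewMatrix (W \ {u | u ∈ c.support}), z ∈ nullOn G.skewMatrix W := by
    intro z hz
    refine ⟨fun u hu => hz.1 u fun h => hu h.1, fun u hu => ?_⟩
    by_cases huc : u ∈ c.support
    · rw [mulVec_apply_eq_of_forall (z' := 0)]
      · simp
      · intro w hw
        refine hz.1 w fun hwW => hwW.2 ?_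
        exact (c.mem_verts_toSubgraph).1
          (hiso u huc w hwW.1 (skewMatrix_apply_ne_zero.1 hw)).snd_mem
    · exact hz.2 u ⟨hu, huc⟩
  -- Injectivity is read off at positions 0 and 1, where the kernel of the rest vanishes and exactly
  -- one of the two cycle vectors does not.
  let g : (nullOn G.skewMatrix (W \ {u | u ∈ c.support}) × ℝ × ℝ) →ₗ[ℝ] nullOn G.skewMatrix W :=
    LinearMap.coprod (Submodule.inclusion hsub)
      (LinearMap.coprod (LinearMap.toSpanSingleton ℝ _ ⟨_, hα⟩)
        (LinearMap.toSpanSingleton ℝ _ ⟨_, hβ⟩))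
  have hg : Function.Injective g := by
    rw [injective_iff_map_eq_zero]
    rintro ⟨z, a, b⟩ h
    have hval : ∀ u, z.1 u + (a * cycleVector c α u + b * cycleVector c β u) = 0 := by
      intro u
      have := congrFun (congrArg Subtype.val h) u
      simpa [g] using this
    have hz : ∀ i, z.1 (c.getVert i) = 0 := fun i => z.2.1 _ fun h => h.2 (c.getVert_mem_support i)
    have ha : a = 0 := by
      have := hval (c.getVert 0)
      rw [hz, cycleVector_getVert hc hα0 (by omega), cycleVector_getVert hc hβ0 (by omega)] at this
      simpa [α, β, hP0] using this
    have hb : b = 0 := by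
      have := hval (c.getVert 1)
      rw [hz, cycleVector_getVert hc hα0 (by omega), cycleVector_getVert hc hβ0 (by omega)] at this
      have hs00 : s 0 ≠ 0 := left_ne_zero_of_mul_eq_one (hs 0 (by omega))
      simpa [α, β, hP1, hs00] using this
    subst ha hb
    have : z = 0 := by
      apply Subtype.ext
      ext u
      simpa using hval u
    rw [this]
    rfl
  have := LinearMap.finrank_le_finrank_of_injective hg
  rw [finrank_prod, finrank_prod, finrank_self] at this
  exact this

/-- Vectors in the kernel of the adjacency matrix vanish on isolated cycles of length `2 mod 4`. -/
theorem nullity_adjM_le_delete_cycle (hc : c.IsCycle) (hW : ∀ u ∈ c.support, u ∈ W)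
    (hiso : c.IsIsolatedIn W) (hlen : c.length ≡ 2 [MOD 4]) :
    nullity G.adjM W ≤ nullity G.adjM (W \ {u | u ∈ c.support}) := by
  have hM : ∀ u w, G.adjM u w ≠ 0 → G.underlying.Adj u w := fun _ _ => adjM_apply_ne_zero.1
  refine Submodule.finrank_mono fun z hz => ⟨fun u hu => ?_, fun u hu => hz.2 u hu.1⟩
  by_cases huW : u ∈ W
  · have huc : u ∈ c.support := by by_contra h; exact hu ⟨huW, h⟩
    obtain ⟨i, rfl, hi⟩ := Walk.mem_support_iff_exists_getVert.1 huc
    refine eq_zero_of_alternating (ζ := fun i => z (c.getVert i)) (q := c.length) hlen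
      (fun i hi => ?_) (by simp) ?_ hi
    · have hrow := mulVec_getVert_succ hM hc hiso hz.1 hi
      rw [hz.2 _ (hW _ (c.getVert_mem_support _)),
        adjM_apply_eq_one (c.adj_getVert_succ (by omega)).symm,
        adjM_apply_eq_one (c.adj_getVert_succ hi)] at hrow
      show z (c.getVert (i + 2)) = - z (c.getVert i)
      linarith
    · have hrow := mulVec_start hM hc hiso hz.1
      rw [hz.2 _ (hW _ c.start_mem_support), adjM_apply_eq_one (c.adj_snd hc.not_nil),
        adjM_apply_eq_one (c.adj_penultimate hc.not_nil).symm, one_mul, one_mul] at hrow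
      exact hrow.symm
  · exact hz.1 u huW

/-- The nullities of a disjoint union of `k` good cycles and isolated vertices. -/
theorem nullity_adjM_add_le_of_cycles (k : ℕ) (v : Fin k → V)
    (c : ∀ i, G.underlying.Walk (v i) (v i)) (hc : ∀ i, (c i).IsCycle)
    (hgood : ∀ i, G.EvenlyOriented (c i) ∧ (c i).length ≡ 2 [MOD 4])
    (hW : ∀ i, ∀ u ∈ (c i).support, u ∈ W)
    (hd : ∀ i j, i ≠ j → ∀ u ∈ (c i).support, u ∉ (c j).support)
    (hE : ∀ u ∈ W, ∀ w ∈ W, G.underlying.Adj u w → ∃ i, (c i).toSubgraph.Adj u w) :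
    nullity G.adjM W + 2 * k ≤ nullity G.skewMatrix W := by
  induction k generalizing W with
  | zero =>
    have := nullity_eq_of_forall_not_adj (G := G) (W := W) fun u hu w hw huw =>
      (hE u hu w hw huw).elim fun i => i.elim0
    omega
  | succ k ih =>
    have hiso : (c 0).IsIsolatedIn W := by
      intro u hu w hw huw
      obtain ⟨i, hi⟩ := hE u (hW 0 u hu) w hw huw
      have hui : u ∈ (c i).support := ((c i).mem_verts_toSubgraph).1 hi.fst_mem
      by_cases h0 : i = 0
      · subst h0; exact hi
      · exact absurd hu (hd i 0 h0 u hui)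
    have h1 := nullity_adjM_le_delete_cycle (hc 0) (hW 0) hiso (hgood 0).2
    have h2 := nullity_skewMatrix_delete_cycle (hc 0) (hW 0) hiso (hgood 0).1
    have h3 := ih (W := W \ {u | u ∈ (c 0).support}) (fun i => v i.succ) (fun i => c i.succ)
      (fun i => hc _) (fun i => hgood _)
      (fun i u hu => ⟨hW _ u hu, hd _ _ (Fin.succ_ne_zero i) u hu⟩)
      (fun i j hij => hd _ _ fun e => hij (Fin.succ_injective _ e))
      (fun u hu w hw huw => by
        obtain ⟨i, hi⟩ := hE u hu.1 w hw.1 huw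
        have hui : u ∈ (c i).support := ((c i).mem_verts_toSubgraph).1 hi.fst_mem
        obtain ⟨j, rfl⟩ := Fin.exists_succ_eq.2 (fun e : i = 0 => hu.2 (by subst e; exact hui))
        exact ⟨j, hi⟩)
    omega

theorem nullity_adjM_add_le_of_isDisjointCyclesWithIsolated {k : ℕ}
    (hgood : ∀ (v : V) (c : G.underlying.Walk v v), c.IsCycle →
      G.EvenlyOriented c ∧ c.length ≡ 2 [MOD 4])
    (h : (G.underlying.induce W).IsDisjointCyclesWithIsolated k) :
    nullity G.adjM W + 2 * k ≤ nullity G.skewMatrix W := by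
  obtain ⟨C, hC, hd, hE⟩ := h
  choose v c hc hsupp hadj using fun i => (hC i).exists_walk_of_induce
  refine nullity_adjM_add_le_of_cycles k v c hc (fun i => hgood _ _ (hc i)) ?_ ?_ ?_
  · intro i u hu
    exact ((hsupp i u).1 hu).1
  · intro i j hij u hi hj
    obtain ⟨h1, h2⟩ := (hsupp i u).1 hi
    obtain ⟨h3, h4⟩ := (hsupp j u).1 hj
    exact Set.disjoint_left.1 (hd i j hij) h2 h4
  · intro u hu w hw huw
    obtain ⟨i, hi⟩ := hE ⟨u, hu⟩ ⟨w, hw⟩ huw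
    exact ⟨i, hadj i _ _ hi⟩

end Sufficiency

end OrientedGraph

namespace SimpleGraph

theorem DeltaStep.exists_pendantIn {V : Type*} {G : SimpleGraph V} {W W' : Set V}
    (h : G.DeltaStep W W') : ∃ y x, G.PendantIn W y x ∧ W' = W \ {y, x} := by
  obtain ⟨y, x, hp, hyx, rfl⟩ := h
  refine ⟨y, x, ⟨y.2, x.2, hyx, fun u hu hyu => ?_⟩, rfl⟩
  obtain ⟨t, ht⟩ := Set.ncard_eq_one.1 hp
  have h1 : (⟨u, hu⟩ : W) ∈ (G.induce W).neighborSet y := hyu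
  have h2 : x ∈ (G.induce W).neighborSet y := hyx
  rw [ht, Set.mem_singleton_iff] at h1 h2
  exact congrArg Subtype.val (h1.trans h2.symm)

end SimpleGraph

namespace OrientedGraph

open SimpleGraph

/-! ### Invariance of the nullities under δ-transformations. -/

section

variable {V : Type*} [Fintype V] {G : OrientedGraph V}

theorem nullity_eq_of_reflTransGen {W W' : Set V}
    (h : Relation.ReflTransGen G.underlying.DeltaStep W W') :
    nullity G.adjM W' = nullity G.adjM W ∧
      nullity G.skewMatrix W' = nullity G.skewMatrix W := by
  induction h with
  | refl => exact ⟨rfl, rfl⟩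
  | tail _ hstep ih =>
    obtain ⟨y, x, hp, rfl⟩ := hstep.exists_pendantIn
    exact ⟨(nullity_adjM_delete_pendant hp).trans ih.1,
      (nullity_skewMatrix_delete_pendant hp).trans ih.2⟩

end

end OrientedGraph

namespace OrientedGraph

open SimpleGraph

/-! ### The incidence matrix and the dimension of the cycle space. -/

section Incidence

variable {V : Type*}

/-- The arcs of an oriented graph. -/
abbrev Arc (G : OrientedGraph V) : Type _ := {p : V × V // G.Adj p.1 p.2}

open Classical in
/-- The incidence matrix of an oriented graph. -/
noncomputable def incidence (G : OrientedGraph V) : Matrix V G.Arc ℝ :=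
  Matrix.of fun u e => (if u = e.1.1 then 1 else 0) - (if u = e.1.2 then 1 else 0)

variable {G : OrientedGraph V}

theorem card_edgeSet_underlying : Nat.card G.underlying.edgeSet = Nat.card G.Arc := by
  symm
  refine Nat.card_congr (Equiv.ofBijective
    (fun e : G.Arc => ⟨s(e.1.1, e.1.2), Or.inl e.2⟩) ⟨?_, ?_⟩)
  · rintro ⟨⟨a, b⟩, h⟩ ⟨⟨a', b'⟩, h'⟩ he
    rcases Sym2.eq_iff.1 (congrArg Subtype.val he) with ⟨h1, h2⟩ | ⟨h1, h2⟩
    · simp only at h1 h2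
      subst h1 h2; rfl
    · simp only at h1 h2
      subst h1 h2
      exact absurd h' (G.asymm _ _ h)
  · rintro ⟨e, he⟩
    induction e with
    | _ a b =>
      rcases he with h | h
      · exact ⟨⟨(a, b), h⟩, rfl⟩
      · exact ⟨⟨(b, a), h⟩, Subtype.ext Sym2.eq_swap⟩

open Classical in
/-- Extension by zero of a function on the arcs to all pairs of vertices. -/
noncomputable def arcExtend (g : G.Arc → ℝ) (u v : V) : ℝ :=
  if h : G.Adj u v then g ⟨(u, v), h⟩ else 0

theorem arcExtend_of_adj (g : G.Arc → ℝ) {u v : V} (h : G.Adj u v) :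
    arcExtend g u v = g ⟨(u, v), h⟩ := dif_pos h

theorem arcExtend_of_not_adj (g : G.Arc → ℝ) {u v : V} (h : ¬ G.Adj u v) :
    arcExtend g u v = 0 := dif_neg h

theorem arcExtend_add (g g' : G.Arc → ℝ) (u v : V) :
    arcExtend (g + g') u v = arcExtend g u v + arcExtend g' u v := by
  by_cases h : G.Adj u v <;> simp [arcExtend, h]

theorem arcExtend_smul (r : ℝ) (g : G.Arc → ℝ) (u v : V) :
    arcExtend (r • g) u v = r * arcExtend g u v := by
  by_cases h : G.Adj u v <;> simp [arcExtend, h]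

variable [Fintype V] [Fintype G.Arc]

theorem sum_mul_arc (φ : V → V → ℝ) (g : G.Arc → ℝ) :
    ∑ e : G.Arc, φ e.1.1 e.1.2 * g e = ∑ u, ∑ v, φ u v * arcExtend g u v := by
  classical
  rw [← Fintype.sum_prod_type' (f := fun u v => φ u v * arcExtend g u v),
    ← Finset.sum_filter_of_ne (p := fun p : V × V => G.Adj p.1 p.2) fun p _ hp => by
      by_contra h
      exact hp (by rw [arcExtend_of_not_adj _ h, mul_zero]),
    Finset.sum_subtype _ (p := fun p : V × V => G.Adj p.1 p.2) (fun p => by simp)]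
  exact Finset.sum_congr rfl fun e _ => by rw [arcExtend_of_adj g e.2]

theorem incidence_mulVec (g : G.Arc → ℝ) (u : V) :
    G.incidence.mulVec g u = ∑ v, (arcExtend g u v - arcExtend g v u) := by
  classical
  have h1 := sum_mul_arc (fun a b => (if u = a then 1 else 0) - (if u = b then 1 else 0)) g
  have h2 : G.incidence.mulVec g u = ∑ e : G.Arc,
      ((if u = e.1.1 then (1 : ℝ) else 0) - (if u = e.1.2 then 1 else 0)) * g e := by
    simp only [Matrix.mulVec, dotProduct, incidence, Matrix.of_apply]
  rw [h2, h1]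
  simp only [sub_mul, Finset.sum_sub_distrib]
  congr 1
  · rw [Finset.sum_eq_single u]
    · simp
    · intro b _ hb; simp [hb.symm]
    · simp
  · simp

/-- The flows are the kernel of the incidence matrix. -/
theorem flowDim_univ_eq_finrank_ker :
    G.underlying.flowDim Set.univ = finrank ℝ (LinearMap.ker G.incidence.mulVecLin) := by
  let L : LinearMap.ker G.incidence.mulVecLin →ₗ[ℝ] G.underlying.flowOn Set.univ :=
    { toFun := fun g => ⟨fun u v => arcExtend g.1 u v - arcExtend g.1 v u, by
        refine ⟨fun u v => by ring, fun u v h => ⟨?_, trivial, trivial⟩, fun u => ?_⟩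
        · by_contra hn
          have h1 : ¬ G.Adj u v := fun h => hn (Or.inl h)
          have h2 : ¬ G.Adj v u := fun h => hn (Or.inr h)
          exact h (by simp [arcExtend_of_not_adj _ h1, arcExtend_of_not_adj _ h2])
        · rw [← incidence_mulVec]
          exact congrFun (LinearMap.mem_ker.1 g.2) u⟩
      map_add' := fun g g' => by
        apply Subtype.ext
        ext u v
        simp only [Submodule.coe_add, arcExtend_add, Pi.add_apply]
        ring
      map_smul' := fun r g => by
        apply Subtype.ext
        ext u v
        simp only [Submodule.coe_smul, arcExtend_smul, Pi.smul_apply, RingHom.id_apply,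
          smul_eq_mul]
        ring }
  have hL : Function.Bijective L := by
    constructor
    · rw [injective_iff_map_eq_zero]
      intro g hg
      apply Subtype.ext
      ext ⟨⟨u, v⟩, h⟩
      have := congrFun (congrFun (congrArg Subtype.val hg) u) v
      simpa [L, arcExtend_of_adj _ h, arcExtend_of_not_adj _ (G.asymm _ _ h)] using this
    · rintro ⟨f, hf⟩
      have key : ∀ u v, arcExtend (fun e : G.Arc => f e.1.1 e.1.2) u v -
          arcExtend (fun e : G.Arc => f e.1.1 e.1.2) v u = f u v := by
        intro u v
        by_cases h1 : G.Adj u v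
        · rw [arcExtend_of_adj _ h1, arcExtend_of_not_adj _ (G.asymm _ _ h1), sub_zero]
        · by_cases h2 : G.Adj v u
          · rw [arcExtend_of_not_adj _ h1, arcExtend_of_adj _ h2, zero_sub, hf.1 u v]
          · rw [arcExtend_of_not_adj _ h1, arcExtend_of_not_adj _ h2, sub_zero]
            by_contra h
            exact (hf.2.1 u v (Ne.symm h)).1.elim h1 h2
      refine ⟨⟨fun e => f e.1.1 e.1.2, ?_⟩, Subtype.ext (funext fun u => funext fun v => key u v)⟩
      rw [LinearMap.mem_ker]
      ext u
      rw [Matrix.mulVecLin_apply, incidence_mulVec]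
      simp only [key]
      exact hf.2.2 u
  exact (LinearEquiv.ofBijective L hL).finrank_eq.symm

/-- The transposed incidence matrix kills exactly the functions constant along edges. This is also
the Laplacian kernel, whose dimension counts components. -/
theorem rank_incidence_add :
    G.incidence.rank + Nat.card G.underlying.ConnectedComponent = Fintype.card V := by
  classical
  have hker : LinearMap.ker G.incidence.transpose.mulVecLin =
      LinearMap.ker (G.underlying.lapMatrix ℝ).toLin' := by
    ext x
    rw [LinearMap.mem_ker, LinearMap.mem_ker, Matrix.toLin'_apply, Matrix.mulVecLin_apply,
      lapMatrix_mulVec_eq_zero_iff_forall_adj]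
    have hrow : ∀ e : G.Arc, G.incidence.transpose.mulVec x e = x e.1.1 - x e.1.2 := by
      intro e
      simp [Matrix.mulVec, dotProduct, incidence, sub_mul, Finset.sum_sub_distrib]
    constructor
    · intro h u v huv
      rcases huv with huv | huv
      · have := congrFun h ⟨(u, v), huv⟩
        rw [hrow] at this
        simpa [sub_eq_zero] using this
      · have := congrFun h ⟨(v, u), huv⟩
        rw [hrow] at this
        exact (by simpa [sub_eq_zero] using this : x v = x u).symm
    · intro h
      ext e
      rw [hrow, h _ _ (Or.inl e.2), sub_self, Pi.zero_apply]
  rw [Nat.card_eq_fintype_card, card_connectedComponent_eq_finrank_ker_toLin'_lapMatrix, ← hker,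
    ← Matrix.rank_transpose, Matrix.rank, LinearMap.finrank_range_add_finrank_ker,
    finrank_fintype_fun_eq_card]

end Incidence

/-! ### From ranks and cycle dimension to nullities and flows. -/

section Main

variable {V : Type*} [Fintype V]

theorem cycleDim_underlying (G : OrientedGraph V) :
    G.underlying.cycleDim = G.underlying.flowDim Set.univ := by
  classical
  have h1 := flowDim_univ_eq_finrank_ker (G := G)
  have h2 := rank_incidence_add (G := G)
  have h3 := LinearMap.finrank_range_add_finrank_ker G.incidence.mulVecLin
  rw [finrank_fintype_fun_eq_card, ← Matrix.rank, ← h1] at h3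
  rw [cycleDim, card_edgeSet_underlying, Nat.card_eq_fintype_card (α := G.Arc), ← h3,
    Nat.card_eq_fintype_card (α := V), ← h2]
  push_cast
  ring

theorem lowerOptimal_iff (G : OrientedGraph V) :
    G.LowerOptimal ↔ G.LowerOptimalOn Set.univ := by
  have h1 := rank_add_nullity_univ G.adjM
  have h2 := rank_add_nullity_univ G.skewMatrix
  have h3 : G.underlying.adjRank = G.adjM.rank := rfl
  have h4 : G.skewRank = G.skewMatrix.rank := rfl
  rw [LowerOptimal, cycleDim_underlying, LowerOptimalOn, h3, h4]
  omega

end Main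

end OrientedGraph

theorem theorem1p3 {V : Type*} [Fintype V] (G : OrientedGraph V) :
    G.LowerOptimal ↔
      G.underlying.CyclesPairwiseDisjoint ∧
      (∀ (v : V) (c : G.underlying.Walk v v), c.IsCycle →
        G.EvenlyOriented c ∧ c.length ≡ 2 [MOD 4]) ∧
      G.underlying.ReducesToDisjointCycles := by
  rw [OrientedGraph.lowerOptimal_iff]
  constructor
  · intro h
    refine ⟨fun C D hC hD hne => h.disjoint_of_ne hC hD (Set.subset_univ _) (Set.subset_univ _) hne,
      fun v c hc => h.cycle_condition hc fun u _ => Set.mem_univ u, ?_⟩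
    obtain ⟨W, h1, h2⟩ := h.exists_isDisjointCyclesWithIsolated
    exact ⟨W, _, h1, G.cycleDim_underlying.symm, h2⟩
  · rintro ⟨-, hgood, W, k, hred, hk, hW⟩
    obtain ⟨h1, h2⟩ := OrientedGraph.nullity_eq_of_reflTransGen hred
    have h3 := OrientedGraph.nullity_adjM_add_le_of_isDisjointCyclesWithIsolated hgood hW
    have h4 := OrientedGraph.nullity_skewMatrix_le G Set.univ
    rw [G.cycleDim_underlying] at hk
    unfold OrientedGraph.LowerOptimalOn
    omega
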